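/- Let $\mathfrak s$ be the Schrödinger Lie algebra over $\mathbb C$, i.e. the complex Lie algebra with basis $e,h,f,p,q,z$ and brackets $[h,e]=2e$, $[h,f]=-2f$, $[e,f]=h$, $[e,p]=0$, $[h,p]=p$, $[f,p]=q$, $[e,q]=p$, $[h,q]=-q$, $[f,q]=0$, $[p,q]=z$, and $z$ central. Let $\mathfrak g=\operatorname{span}(e,h,f)\cong\mathfrak{sl}_2$ be its Levi subalgebra. An $\mathfrak s$-module is called a $\mathfrak g$-Harish-Chandra module if its restriction to $\mathfrak g$ is a direct sum of simple finite-dimensional $\mathfrak g$-modules in which each isomorphism class of simple finite-dimensional $\mathfrak g$-modules occurs with finite multiplicity. Let $V$ be a simple infinite-dimensional $\mathfrak g$-Harish-Chandra module for $\mathfrak s$. Then $$\operatorname{Ext}^1(V,V)\cong\mathbb C$$ as complex vector spaces, where $\operatorname{Ext}^1$ is taken in the category of all $\mathfrak s$-modules, i.e. of modules over the universal enveloping algebra $U(\mathfrak s)$. -/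

import Mathlib

/-- The underlying space of the Schrödinger Lie algebra: the coordinates `0, 1, 2, 3, 4, 5` are the
coefficients of the basis vectors `e, h, f, p, q, z`, in this order. -/
def SchrodingerAlgebra : Type := Fin 6 → ℂ

namespace SchrodingerAlgebra

noncomputable instance : AddCommGroup SchrodingerAlgebra := inferInstanceAs (AddCommGroup (Fin 6 → ℂ))

noncomputable instance : Module ℂ SchrodingerAlgebra := inferInstanceAs (Module ℂ (Fin 6 → ℂ))

@[ext] theorem ext {x y : SchrodingerAlgebra} (h : ∀ i : Fin 6, x i = y i) : x = y := funext h

@[simp] theorem add_apply (x y : SchrodingerAlgebra) (i : Fin 6) : (x + y) i = x i + y i := rfl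

@[simp] theorem neg_apply (x : SchrodingerAlgebra) (i : Fin 6) : (-x) i = -x i := rfl

@[simp] theorem zero_apply (i : Fin 6) : (0 : SchrodingerAlgebra) i = 0 := rfl

@[simp] theorem smul_apply (c : ℂ) (x : SchrodingerAlgebra) (i : Fin 6) : (c • x) i = c * x i := rfl

/-- The bracket, the bilinear alternating extension of
`[h,e] = 2e`, `[h,f] = -2f`, `[e,f] = h`, `[h,p] = p`, `[h,q] = -q`, `[e,q] = p`, `[f,p] = q`,
`[p,q] = z`, the other brackets of basis vectors being zero
(see the lemmas on brackets of basis vectors below). -/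
noncomputable instance : Bracket SchrodingerAlgebra SchrodingerAlgebra where
  bracket x y :=
    ![2 * (x 1 * y 0 - x 0 * y 1),
      x 0 * y 2 - x 2 * y 0,
      -2 * (x 1 * y 2 - x 2 * y 1),
      (x 1 * y 3 - x 3 * y 1) + (x 0 * y 4 - x 4 * y 0),
      (x 2 * y 3 - x 3 * y 2) - (x 1 * y 4 - x 4 * y 1),
      x 3 * y 4 - x 4 * y 3]

@[simp] theorem lie_apply_0 (x y : SchrodingerAlgebra) :
    ⁅x, y⁆ 0 = 2 * (x 1 * y 0 - x 0 * y 1) := rfl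

@[simp] theorem lie_apply_1 (x y : SchrodingerAlgebra) :
    ⁅x, y⁆ 1 = x 0 * y 2 - x 2 * y 0 := rfl

@[simp] theorem lie_apply_2 (x y : SchrodingerAlgebra) :
    ⁅x, y⁆ 2 = -2 * (x 1 * y 2 - x 2 * y 1) := rfl

@[simp] theorem lie_apply_3 (x y : SchrodingerAlgebra) :
    ⁅x, y⁆ 3 = (x 1 * y 3 - x 3 * y 1) + (x 0 * y 4 - x 4 * y 0) := rfl

@[simp] theorem lie_apply_4 (x y : SchrodingerAlgebra) :
    ⁅x, y⁆ 4 = (x 2 * y 3 - x 3 * y 2) - (x 1 * y 4 - x 4 * y 1) := rfl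

@[simp] theorem lie_apply_5 (x y : SchrodingerAlgebra) :
    ⁅x, y⁆ 5 = x 3 * y 4 - x 4 * y 3 := rfl

noncomputable instance : LieRing SchrodingerAlgebra where
  add_lie x y w := by ext i; fin_cases i <;> simp <;> ring
  lie_add x y w := by ext i; fin_cases i <;> simp <;> ring
  lie_self x := by ext i; fin_cases i <;> simp <;> ring
  leibniz_lie x y w := by ext i; fin_cases i <;> simp <;> ring

noncomputable instance : LieAlgebra ℂ SchrodingerAlgebra where
  lie_smul c x y := by ext i; fin_cases i <;> simp <;> ring

/-- The basis `e, h, f, p, q, z` of the Schrödinger Lie algebra. -/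
noncomputable def basis : Module.Basis (Fin 6) ℂ SchrodingerAlgebra := Pi.basisFun ℂ (Fin 6)

noncomputable def e : SchrodingerAlgebra := basis 0
noncomputable def h : SchrodingerAlgebra := basis 1
noncomputable def f : SchrodingerAlgebra := basis 2
noncomputable def p : SchrodingerAlgebra := basis 3
noncomputable def q : SchrodingerAlgebra := basis 4
noncomputable def z : SchrodingerAlgebra := basis 5

theorem basis_apply (i j : Fin 6) : basis i j = if j = i then 1 else 0 := by
  have : basis i j = (Pi.single i (1 : ℂ) : Fin 6 → ℂ) j :=
    congrFun (Pi.basisFun_apply ℂ (Fin 6) i) j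
  rw [this, Pi.single_apply]

theorem lie_h_e : ⁅h, e⁆ = (2 : ℂ) • e := by
  ext i; fin_cases i <;> simp [h, e, basis_apply]
theorem lie_h_f : ⁅h, f⁆ = (-2 : ℂ) • f := by
  ext i; fin_cases i <;> simp [h, f, basis_apply]
theorem lie_e_f : ⁅e, f⁆ = h := by
  ext i; fin_cases i <;> simp [e, h, f, basis_apply]
theorem lie_e_p : ⁅e, p⁆ = 0 := by
  ext i; fin_cases i <;> simp [e, p, basis_apply]
theorem lie_h_p : ⁅h, p⁆ = p := by
  ext i; fin_cases i <;> simp [h, p, basis_apply]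
theorem lie_f_p : ⁅f, p⁆ = q := by
  ext i; fin_cases i <;> simp [f, p, q, basis_apply]
theorem lie_e_q : ⁅e, q⁆ = p := by
  ext i; fin_cases i <;> simp [e, p, q, basis_apply]
theorem lie_h_q : ⁅h, q⁆ = -q := by
  ext i; fin_cases i <;> simp [h, q, basis_apply]
theorem lie_f_q : ⁅f, q⁆ = 0 := by
  ext i; fin_cases i <;> simp [f, q, basis_apply]
theorem lie_p_q : ⁅p, q⁆ = z := by
  ext i; fin_cases i <;> simp [p, q, z, basis_apply]
theorem lie_z (x : SchrodingerAlgebra) : ⁅x, z⁆ = 0 := by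
  ext i; fin_cases i <;> simp [z, basis_apply]

/-- The Levi subalgebra `sl₂` of the Schrödinger Lie algebra: the span of `e, h, f`, i.e. the
vectors whose coefficients at `p, q, z` vanish. -/
noncomputable def sl2 : LieSubalgebra ℂ SchrodingerAlgebra where
  carrier := {x | x 3 = 0 ∧ x 4 = 0 ∧ x 5 = 0}
  add_mem' := by
    rintro x y ⟨h3, h4, h5⟩ ⟨k3, k4, k5⟩
    simp [h3, h4, h5, k3, k4, k5]
  zero_mem' := by simp
  smul_mem' := by
    rintro c x ⟨h3, h4, h5⟩
    simp [h3, h4, h5]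
  lie_mem' := by
    rintro x y ⟨h3, h4, h5⟩ ⟨k3, k4, k5⟩
    simp [h3, h4, k3, k4]

theorem sl2_toSubmodule_eq_span : sl2.toSubmodule = Submodule.span ℂ {e, h, f} := by
  apply le_antisymm
  · rintro x ⟨h3, h4, h5⟩
    have hx : x = x 0 • e + x 1 • h + x 2 • f := by
      ext i
      fin_cases i <;> simp [e, h, f, basis_apply, h3, h4, h5]
    rw [hx]
    refine add_mem (add_mem ?_ ?_) ?_ <;>
      exact Submodule.smul_mem _ _ (Submodule.subset_span (by simp))
  · rw [Submodule.span_le]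
    rintro x (rfl | rfl | rfl)
    · exact ⟨by simp [e, basis_apply], by simp [e, basis_apply], by simp [e, basis_apply]⟩
    · exact ⟨by simp [h, basis_apply], by simp [h, basis_apply], by simp [h, basis_apply]⟩
    · exact ⟨by simp [f, basis_apply], by simp [f, basis_apply], by simp [f, basis_apply]⟩

end SchrodingerAlgebra

section Modules

universe u v

open Classical in
/-- For a Lie subalgebra `g` of a complex Lie algebra `L`, an `L`-module `V` is a `g`-Harish-Chandra
module if its restriction to `g` is an (internal) direct sum of simple finite-dimensional
`g`-submodules `W i` in which each isomorphism class occurs only finitely many times. -/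
def IsHarishChandraModule {L : Type u} [LieRing L] [LieAlgebra ℂ L] (g : LieSubalgebra ℂ L)
    (V : Type v) [AddCommGroup V] [Module ℂ V] [LieRingModule L V] [LieModule ℂ L V] : Prop :=
  ∃ (ι : Type v) (W : ι → LieSubmodule ℂ g V),
    DirectSum.IsInternal (fun i => (W i).toSubmodule) ∧
    (∀ i, LieModule.IsIrreducible ℂ g (W i) ∧ FiniteDimensional ℂ (W i)) ∧
    ∀ i, {j | Nonempty (W j ≃ₗ⁅ℂ, g⁆ W i)}.Finite

/-- The `U(L)`-module attached to an `L`-module `V`, as an object of the category of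
`U(L)`-modules. -/
noncomputable def envelopingModule (L : Type u) [LieRing L] [LieAlgebra ℂ L]
    (V : Type v) [AddCommGroup V] [Module ℂ V] [LieRingModule L V] [LieModule ℂ L V] :
    ModuleCat.{v} (UniversalEnvelopingAlgebra ℂ L) :=
  letI : Module (UniversalEnvelopingAlgebra ℂ L) V :=
    Module.compHom V (UniversalEnvelopingAlgebra.lift ℂ (LieModule.toEnd ℂ L V)).toRingHom
  ModuleCat.of (UniversalEnvelopingAlgebra ℂ L) V

theorem envelopingModule_ι_smul {L : Type u} [LieRing L] [LieAlgebra ℂ L]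
    {V : Type v} [AddCommGroup V] [Module ℂ V] [LieRingModule L V] [LieModule ℂ L V]
    (x : L) (v : V) :
    (UniversalEnvelopingAlgebra.ι ℂ x • (show envelopingModule L V from v) :
      envelopingModule L V) = (show envelopingModule L V from (⁅x, v⁆ : V)) := by
  change (UniversalEnvelopingAlgebra.lift ℂ (LieModule.toEnd ℂ L V)
    (UniversalEnvelopingAlgebra.ι ℂ x)) v = ⁅x, v⁆
  rw [UniversalEnvelopingAlgebra.lift_ι_apply]
  rfl

theorem envelopingModule_algebraMap_smul {L : Type u} [LieRing L] [LieAlgebra ℂ L]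
    {V : Type v} [AddCommGroup V] [Module ℂ V] [LieRingModule L V] [LieModule ℂ L V]
    (c : ℂ) (v : V) :
    (algebraMap ℂ (UniversalEnvelopingAlgebra ℂ L) c • (show envelopingModule L V from v) :
      envelopingModule L V) = (show envelopingModule L V from c • v) := by
  change (UniversalEnvelopingAlgebra.lift ℂ (LieModule.toEnd ℂ L V)
    (algebraMap ℂ _ c)) v = c • v
  rw [AlgHom.commutes]
  rfl

end Modules

/-
Resolving `V` by the free module `U(L) ⊗ V` identifies `Ext¹(V, V)` with `Der / Inn` for the
derivations `D` of `L` in `End V`, where `D` corresponds to an extension of `V` by itself. Let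
`L` be the Schrödinger algebra. By Dixmier's form of Schur's lemma `z` acts on `V` by a scalar `c`,
and `D z`, which commutes with `L`, is a scalar too.

* If `D z = 0`, then `z` acts by `c` on the extension. Let `n` be the smallest highest weight of `V`
  for `sl₂` and `v` a highest weight vector of weight `n`. As weight `n - 1` is missing,
  `(n + 1) q v = f p v`, and `v` is determined up to a scalar because every vector of `V` is a
  combination of the `f ^ i p ^ k v`. A highest weight lift of `v` to the extension inherits this
  relation, so that it generates a complement and `D` is inner.
* `c ≠ 0` when `V` is infinite-dimensional: for `c = 0` the vector `p v` satisfies the same relation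
  and would generate `V` from weight `n + 1` on, so `p v = 0` and `V` is spanned by the `f ^ i v`.
  Hence the derivation of `L` giving `sl₂`, `p, q` and `z` the degrees `0`, `1/2` and `1`, followed
  by the action on `V`, takes the nonzero value `c` at `z` and is not inner.
-/

section SpanLieSubmodule

variable {R L V : Type*} [CommRing R] [LieRing L] [LieAlgebra R L]
  [AddCommGroup V] [Module R V] [LieRingModule L V] [LieModule R L V] {X : Set L} {Y : Set V}

theorem lie_mem_span_of_forall (hY : ∀ x ∈ X, ∀ y ∈ Y, ⁅x, y⁆ ∈ Submodule.span R Y) {x : L} {w : V}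
    (hx : x ∈ Submodule.span R X) (hw : w ∈ Submodule.span R Y) : ⁅x, w⁆ ∈ Submodule.span R Y := by
  induction hx, hw using Submodule.span_induction₂ with
  | mem_mem x w hx hw => exact hY x hx w hw
  | zero_left => rw [zero_lie]; exact zero_mem _
  | zero_right => rw [lie_zero]; exact zero_mem _
  | add_left x y w _ _ _ hx hy => rw [add_lie]; exact add_mem hx hy
  | add_right x y w _ _ _ hx hy => rw [lie_add]; exact add_mem hx hy
  | smul_left r x w _ _ h => rw [smul_lie]; exact Submodule.smul_mem _ r h
  | smul_right r x w _ _ h => rw [lie_smul]; exact Submodule.smul_mem _ r h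

/-- The span of `Y` as a Lie submodule, when `L` is spanned by elements mapping `Y` to its span. -/
def spanLieSubmodule (hX : Submodule.span R X = ⊤)
    (hY : ∀ x ∈ X, ∀ y ∈ Y, ⁅x, y⁆ ∈ Submodule.span R Y) : LieSubmodule R L V where
  __ := Submodule.span R Y
  lie_mem hw := lie_mem_span_of_forall hY (hX ▸ Submodule.mem_top) hw

end SpanLieSubmodule

section DixmierSchur

universe u v

open Cardinal Polynomial

theorem isUnit_aeval_of_spectrum_eq_empty {K A : Type*} [Field K] [IsAlgClosed K] [Ring A]
    [Algebra K A] {a : A} (ha : spectrum K a = ∅) {p : K[X]} (hp : p ≠ 0) :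
    IsUnit (aeval a p) := by
  rw [(IsAlgClosed.splits p).eq_prod_roots, map_mul, aeval_C]
  refine ((IsUnit.mk0 _ (leadingCoeff_ne_zero.mpr hp)).map _).mul ?_
  by_contra h
  obtain ⟨k, hk, -⟩ := spectrum.exists_mem_of_not_isUnit_aeval_prod h
  exact (ha ▸ hk : k ∈ (∅ : Set K))

theorem linearIndependent_of_spectrum_eq_empty {K M : Type*} [Field K] [IsAlgClosed K]
    [AddCommGroup M] [Module K M] {φ : Module.End K M} (hφ : spectrum K φ = ∅) {v : M}
    (hv : v ≠ 0) {w : K → M} (hw : ∀ c, aeval φ (X - C c) (w c) = v) :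
    LinearIndependent K w := by
  classical
  refine linearIndependent_iff'.mpr fun s a hs c hc => ?_
  set p : K[X] := ∑ c ∈ s, a c • ∏ j ∈ s.erase c, (X - C j) with hp
  have hpv : aeval φ p v = 0 := by
    have h := congrArg (aeval φ (∏ j ∈ s, (X - C j))) hs
    rw [map_zero, map_sum] at h
    rw [hp, map_sum, LinearMap.sum_apply, ← h]
    refine Finset.sum_congr rfl fun c hc => ?_
    rw [← hw c, ← s.prod_erase_mul _ hc, map_smul, map_smul, LinearMap.smul_apply, map_mul,
      Module.End.mul_apply]
  have hp0 : p = 0 := by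
    by_contra h
    exact hv (((Module.End.isUnit_iff _).mp (isUnit_aeval_of_spectrum_eq_empty hφ h)).injective
      (hpv.trans (map_zero _).symm))
  have heval : a c * ∏ j ∈ s.erase c, (c - j) = 0 := by
    have h := congrArg (eval c) hp0
    rw [hp, eval_finsetSum, Finset.sum_eq_single_of_mem c hc, eval_smul, eval_prod] at h
    · simpa using h
    · intro b _ hbc
      rw [eval_smul, eval_prod, Finset.prod_eq_zero (Finset.mem_erase.mpr ⟨hbc.symm, hc⟩)
        (by simp), smul_zero]
  exact (mul_eq_zero.mp heval).resolve_right
    (Finset.prod_ne_zero_iff.mpr fun j hj => sub_ne_zero.mpr (Finset.ne_of_mem_erase hj).symm)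

theorem spectrum_nonempty_of_rank_lt {K : Type u} {M : Type v} [Field K] [IsAlgClosed K]
    [AddCommGroup M] [Module K M] [Nontrivial M]
    (h : lift.{u} (Module.rank K M) < lift.{v} #K) (φ : Module.End K M) :
    (spectrum K φ).Nonempty := by
  by_contra! hφ
  obtain ⟨v, hv⟩ := exists_ne (0 : M)
  have hsurj (c : K) : ∃ w, aeval φ (X - C c) w = v :=
    ((Module.End.isUnit_iff _).mp
      (isUnit_aeval_of_spectrum_eq_empty hφ (X_sub_C_ne_zero c))).surjective v
  choose w hw using hsurj
  exact (linearIndependent_of_spectrum_eq_empty hφ hv hw).cardinal_lift_le_rank.not_gt h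

variable {K : Type u} {L : Type*} {V : Type v} [Field K] [LieRing L] [LieAlgebra K L]
  [AddCommGroup V] [Module K V] [LieRingModule L V] [LieModule K L V]
  [LieModule.IsIrreducible K L V]

theorem rank_le_aleph0_of_isIrreducible {X : Set L} (hX : X.Countable)
    (hspan : Submodule.span K X = ⊤) : Module.rank K V ≤ ℵ₀ := by
  have := hX.to_subtype
  have := LieModule.nontrivial_of_isIrreducible K L V
  obtain ⟨v, hv⟩ := exists_ne (0 : V)
  let words : List X → V := List.foldr (fun x w => ⁅(x : L), w⁆) v
  have lie_words : ∀ x ∈ X, ∀ w ∈ Set.range words, ⁅x, w⁆ ∈ Submodule.span K (Set.range words) := by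
    rintro x hx _ ⟨l, rfl⟩
    exact Submodule.subset_span ⟨⟨x, hx⟩ :: l, rfl⟩
  have htop : spanLieSubmodule hspan lie_words = ⊤ :=
    (eq_bot_or_eq_top _).resolve_left fun h => hv <|
      (LieSubmodule.eq_bot_iff _).mp h v (Submodule.subset_span ⟨[], rfl⟩)
  have hwords : Submodule.span K (Set.range words) = ⊤ := congrArg LieSubmodule.toSubmodule htop
  calc Module.rank K V = Module.rank K (Submodule.span K (Set.range words)) := by
        rw [hwords, rank_top]
    _ ≤ #(Set.range words) := rank_span_le _
    _ ≤ ℵ₀ := (Set.countable_range words).le_aleph0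

/-- Dixmier's form of Schur's lemma: over an uncountable field no finiteness of `V` is needed. -/
theorem exists_forall_eq_smul_of_isIrreducible [IsAlgClosed K] [Uncountable K] {X : Set L}
    (hX : X.Countable) (hspan : Submodule.span K X = ⊤) (φ : V →ₗ⁅K,L⁆ V) :
    ∃ c : K, ∀ v, φ v = c • v := by
  have := LieModule.nontrivial_of_isIrreducible K L V
  have hrank : lift.{u} (Module.rank K V) < lift.{v} #K :=
    (lift_le_aleph0.mpr (rank_le_aleph0_of_isIrreducible hX hspan)).trans_lt
      (aleph0_lt_lift.mpr (aleph0_lt_mk_iff.mpr inferInstance))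
  obtain ⟨c, hc⟩ := spectrum_nonempty_of_rank_lt hrank (φ : Module.End K V)
  refine ⟨c, fun v => ?_⟩
  let ψ : V →ₗ⁅K,L⁆ V := c • LieModuleHom.id - φ
  have hψ : ¬ Function.Bijective ψ := fun h => hc ((Module.End.isUnit_iff _).mpr h)
  rcases eq_bot_or_eq_top ψ.ker with hker | hker
  · refine absurd ⟨ψ.ker_eq_bot.mp hker, ψ.range_eq_top.mp ?_⟩ hψ
    refine (eq_bot_or_eq_top _).resolve_left fun h => ?_
    obtain ⟨w, hw⟩ := exists_ne (0 : V)
    refine hw (ψ.ker_eq_bot.mp hker ?_)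
    rw [map_zero]
    exact (LieSubmodule.eq_bot_iff _).mp h _ (ψ.mem_range_self w)
  · have : ψ v = 0 := ψ.mem_ker.mp (hker ▸ LieSubmodule.mem_top v)
    exact (sub_eq_zero.mp this).symm

end DixmierSchur

section DerivationExtension

variable {R L V W : Type*} [CommRing R] [LieRing L] [LieAlgebra R L]
  [AddCommGroup V] [Module R V] [LieRingModule L V] [LieModule R L V]
  [AddCommGroup W] [Module R W] [LieRingModule L W] [LieModule R L W]

/-- The extension of `V` by `W` attached to a derivation `D` of `L` in `Hom(V, W)`: the space
`V × W` with `⁅x, (v, w)⁆ = (⁅x, v⁆, ⁅x, w⁆ + D x v)`. -/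
def DerivationExtension (_D : LieDerivation R L (V →ₗ[R] W)) : Type _ := V × W

namespace DerivationExtension

variable (D : LieDerivation R L (V →ₗ[R] W))

instance : AddCommGroup (DerivationExtension D) := inferInstanceAs (AddCommGroup (V × W))

instance : Module R (DerivationExtension D) := inferInstanceAs (Module R (V × W))

instance : LieRingModule L (DerivationExtension D) where
  bracket x m := (⁅x, m.1⁆, ⁅x, m.2⁆ + D x m.1)
  add_lie x y m := Prod.ext (add_lie x y m.1) (by
    change ⁅x + y, m.2⁆ + D (x + y) m.1 = ⁅x, m.2⁆ + D x m.1 + (⁅y, m.2⁆ + D y m.1)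
    rw [add_lie, map_add, LinearMap.add_apply, add_add_add_comm])
  lie_add x m n := Prod.ext (lie_add x m.1 n.1) (by
    change ⁅x, m.2 + n.2⁆ + D x (m.1 + n.1) = ⁅x, m.2⁆ + D x m.1 + (⁅x, n.2⁆ + D x n.1)
    rw [lie_add, map_add, add_add_add_comm])
  leibniz_lie x y m := Prod.ext (leibniz_lie x y m.1) (by
    change ⁅x, ⁅y, m.2⁆ + D y m.1⁆ + D x ⁅y, m.1⁆ = ⁅⁅x, y⁆, m.2⁆ + D ⁅x, y⁆ m.1 +
      (⁅y, ⁅x, m.2⁆ + D x m.1⁆ + D y ⁅x, m.1⁆)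
    simp only [lie_add, leibniz_lie x y m.2, LieDerivation.apply_lie_eq_sub, LinearMap.sub_apply,
      LieHom.lie_apply]
    abel)

instance : LieModule R L (DerivationExtension D) where
  smul_lie r x m := Prod.ext (smul_lie r x m.1) (by
    change ⁅r • x, m.2⁆ + D (r • x) m.1 = r • (⁅x, m.2⁆ + D x m.1)
    rw [smul_lie, map_smul, LinearMap.smul_apply, smul_add])
  lie_smul r x m := Prod.ext (lie_smul r x m.1) (by
    change ⁅x, r • m.2⁆ + D x (r • m.1) = r • (⁅x, m.2⁆ + D x m.1)
    rw [lie_smul, map_smul, smul_add])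

/-- The projection of the extension onto the quotient module `V`. -/
def fst : DerivationExtension D →ₗ⁅R,L⁆ V where
  __ := LinearMap.fst R V W
  map_lie' := rfl

/-- The inclusion of the submodule `W` in the extension. -/
def inr : W →ₗ⁅R,L⁆ DerivationExtension D where
  __ := LinearMap.inr R V W
  map_lie' {x w} := Prod.ext (lie_zero x).symm (by
    change ⁅x, w⁆ = ⁅x, w⁆ + D x 0
    rw [map_zero, add_zero])

/-- The linear (in general not `L`-equivariant) splitting `v ↦ (v, 0)` of the extension. -/
def inl : V →ₗ[R] DerivationExtension D := LinearMap.inl R V W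

/-- The linear (in general not `L`-equivariant) retraction of the extension onto `W`. -/
def snd : DerivationExtension D →ₗ[R] W := LinearMap.snd R V W

@[simp] theorem fst_inl (v : V) : fst D (inl D v) = v := rfl

@[simp] theorem snd_inr (w : W) : snd D (inr D w) = w := rfl

theorem snd_lie (x : L) (m : DerivationExtension D) :
    snd D ⁅x, m⁆ = ⁅x, snd D m⁆ + D x (fst D m) := rfl

theorem lie_inl (x : L) (v : V) : ⁅x, inl D v⁆ = inl D ⁅x, v⁆ + inr D (D x v) :=
  Prod.ext (add_zero _).symm (by
    change ⁅x, (0 : W)⁆ + D x v = 0 + D x v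
    rw [lie_zero])

theorem inr_injective : Function.Injective (inr D) := LinearMap.inr_injective

theorem fst_surjective : Function.Surjective (fst D) := LinearMap.fst_surjective

theorem fst_eq_zero_iff (m : DerivationExtension D) : fst D m = 0 ↔ ∃ w, inr D w = m :=
  ⟨fun h => ⟨snd D m, Prod.ext h.symm rfl⟩, by rintro ⟨w, rfl⟩; rfl⟩

theorem mem_range_inner_of_section (σ : V →ₗ⁅R,L⁆ DerivationExtension D)
    (hσ : ∀ v, fst D (σ v) = v) : D ∈ LinearMap.range (LieDerivation.inner R L (V →ₗ[R] W)) := by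
  refine ⟨-(snd D ∘ₗ (σ : V →ₗ[R] DerivationExtension D)),
    LieDerivation.ext fun x => LinearMap.ext fun v => ?_⟩
  have hx : snd D (σ ⁅x, v⁆) = ⁅x, snd D (σ v)⁆ + D x v := by
    rw [LieModuleHom.map_lie, snd_lie, hσ]
  change ⁅x, -snd D (σ v)⁆ - -snd D (σ ⁅x, v⁆) = D x v
  rw [hx, lie_neg]
  abel

end DerivationExtension

end DerivationExtension

/-- The outer derivations `Der(L, M) / Inn(L, M)`, i.e. the first Lie algebra cohomology group
`H¹(L, M)`: derivations are the `1`-cocycles and inner derivations the `1`-coboundaries. -/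
abbrev OuterDerivations (R L M : Type*) [CommRing R] [LieRing L] [LieAlgebra R L]
    [AddCommGroup M] [Module R M] [LieRingModule L M] [LieModule R L M] : Type _ :=
  LieDerivation R L M ⧸ LinearMap.range (LieDerivation.inner R L M)

section EnvelopingExt

open CategoryTheory Abelian
open UniversalEnvelopingAlgebra (ι)
open scoped TensorProduct

attribute [local instance] LieRing.ofAssociativeRing

local notation "𝒰" => UniversalEnvelopingAlgebra

universe u v w

/-- A Lie module over `L` which is also a `U(L)`-module, with compatible actions. -/
class IsEnvelopingModule (R L M : Type*) [CommRing R] [LieRing L] [LieAlgebra R L]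
    [AddCommGroup M] [Module R M] [LieRingModule L M] [Module (𝒰 R L) M] : Prop extends
    IsScalarTower R (𝒰 R L) M where
  ι_smul (x : L) (m : M) : ι R x • m = ⁅x, m⁆

section CommRing

variable {R L : Type*} [CommRing R] [LieRing L] [LieAlgebra R L]

theorem envelopingSubalgebra_eq_top {S : Subalgebra R (𝒰 R L)} (hS : ∀ x, ι R x ∈ S) :
    S = ⊤ := by
  let g : L →ₗ⁅R⁆ S :=
    { toFun := fun x => ⟨ι R x, hS x⟩
      map_add' := fun x y => Subtype.ext (map_add _ x y)
      map_smul' := fun c x => Subtype.ext (map_smul _ c x)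
      map_lie' := fun {x y} => Subtype.ext (LieHom.map_lie _ x y) }
  have h : S.val.comp (UniversalEnvelopingAlgebra.lift R g) = AlgHom.id R _ :=
    UniversalEnvelopingAlgebra.hom_ext R (by ext x; simp [g])
  refine eq_top_iff.mpr fun a _ => ?_
  have ha : (UniversalEnvelopingAlgebra.lift R g a : 𝒰 R L) = a := DFunLike.congr_fun h a
  exact ha ▸ (UniversalEnvelopingAlgebra.lift R g a).2

theorem isEnvelopingModule_compHom (M : Type*) [AddCommGroup M] [Module R M] [LieRingModule L M]
    [LieModule R L M] :
    letI := Module.compHom M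
      (UniversalEnvelopingAlgebra.lift R (LieModule.toEnd R L M)).toRingHom
    IsEnvelopingModule R L M :=
  letI := Module.compHom M
    (UniversalEnvelopingAlgebra.lift R (LieModule.toEnd R L M)).toRingHom
  { smul_assoc := fun r a m => congrArg (fun φ : Module.End R M => φ m)
      (map_smul (UniversalEnvelopingAlgebra.lift R (LieModule.toEnd R L M)) r a)
    ι_smul := fun x m => congrArg (fun φ : Module.End R M => φ m)
      (UniversalEnvelopingAlgebra.lift_ι_apply R (LieModule.toEnd R L M) x) }

variable {V W : Type*} [AddCommGroup V] [Module R V] [AddCommGroup W] [Module R W]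
  [Module (𝒰 R L) W]

section Lift

variable [IsScalarTower R (𝒰 R L) W]

/-- The `U(L)`-linear map `U(L) ⊗ V → W`, `a ⊗ v ↦ a • T v`, extending a linear map `T : V → W`;
Mathlib's `LinearMap.liftBaseChange` is its analogue for commutative algebras. -/
noncomputable def envelopingLift (T : V →ₗ[R] W) : 𝒰 R L ⊗[R] V →ₗ[𝒰 R L] W :=
  TensorProduct.AlgebraTensorModule.lift (LinearMap.toSpanSingleton (𝒰 R L) (V →ₗ[R] W) T)

@[simp]
theorem envelopingLift_tmul (T : V →ₗ[R] W) (a : 𝒰 R L) (v : V) :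
    envelopingLift T (a ⊗ₜ v) = a • T v := rfl

theorem exists_eq_envelopingLift (ψ : 𝒰 R L ⊗[R] V →ₗ[𝒰 R L] W) :
    ∃ T : V →ₗ[R] W, ψ = envelopingLift T :=
  ⟨ψ.restrictScalars R ∘ₗ TensorProduct.mk R _ V 1, by ext v; simp⟩

end Lift

variable [LieRingModule L W] [IsEnvelopingModule R L W]
  [LieRingModule L V] [Module (𝒰 R L) V] [IsEnvelopingModule R L V]

theorem map_enveloping_smul (g : V →ₗ⁅R,L⁆ W) (a : 𝒰 R L) (v : V) :
    g (a • v) = a • g v := by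
  let S : Subalgebra R (𝒰 R L) :=
    { carrier := {a | ∀ v, g (a • v) = a • g v}
      mul_mem' := fun {a b} ha hb v => by rw [mul_smul, mul_smul, ha, hb]
      add_mem' := fun {a b} ha hb v => by rw [add_smul, add_smul, map_add, ha, hb]
      algebraMap_mem' := fun r v => by rw [algebraMap_smul, algebraMap_smul, map_smul] }
  have hS : S = ⊤ := envelopingSubalgebra_eq_top fun x v => by
    rw [IsEnvelopingModule.ι_smul, IsEnvelopingModule.ι_smul, LieModuleHom.map_lie]
  exact (hS ▸ Algebra.mem_top : a ∈ S) v

variable (R L V) in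
/-- The action map `U(L) ⊗ V → V`, whose source is the free `U(L)`-module on the vector space
underlying `V`. -/
noncomputable def envelopingCover : 𝒰 R L ⊗[R] V →ₗ[𝒰 R L] V := envelopingLift LinearMap.id

@[simp]
theorem envelopingCover_tmul (a : 𝒰 R L) (v : V) : envelopingCover R L V (a ⊗ₜ v) = a • v := rfl

theorem envelopingCover_surjective : Function.Surjective (envelopingCover R L V) := fun v =>
  ⟨1 ⊗ₜ v, by simp⟩

variable [LieModule R L V] [LieModule R L W]

variable (R V) in
/-- The element `x ⊗ v - 1 ⊗ ⁅x, v⁆` of the kernel of `U(L) ⊗ V → V`. These elements generate the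
kernel. -/
noncomputable def envelopingRelation :
    L →ₗ[R] V →ₗ[R] LinearMap.ker (envelopingCover R L V) :=
  LinearMap.mk₂ R
    (fun x v => ⟨ι R x ⊗ₜ v - 1 ⊗ₜ ⁅x, v⁆, by
      rw [LinearMap.mem_ker, map_sub, envelopingCover_tmul, envelopingCover_tmul,
        IsEnvelopingModule.ι_smul, one_smul, sub_self]⟩)
    (fun x y v => Subtype.ext (by
      simp only [map_add, add_lie, TensorProduct.add_tmul, TensorProduct.tmul_add,
        Submodule.coe_add]; abel))
    (fun r x v => Subtype.ext (by
      change ι R (r • x) ⊗ₜ v - 1 ⊗ₜ ⁅r • x, v⁆ = r • (ι R x ⊗ₜ v - 1 ⊗ₜ ⁅x, v⁆)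
      rw [map_smul, smul_lie, ← TensorProduct.smul_tmul', TensorProduct.tmul_smul, smul_sub]))
    (fun x v w => Subtype.ext (by
      simp only [lie_add, TensorProduct.tmul_add, Submodule.coe_add]; abel))
    (fun r x v => Subtype.ext (by
      change ι R x ⊗ₜ (r • v) - 1 ⊗ₜ ⁅x, r • v⁆ = r • (ι R x ⊗ₜ v - 1 ⊗ₜ ⁅x, v⁆)
      rw [lie_smul, TensorProduct.tmul_smul, TensorProduct.tmul_smul, smul_sub]))

@[simp]
theorem coe_envelopingRelation (x : L) (v : V) :
    (envelopingRelation R V x v : 𝒰 R L ⊗[R] V) = ι R x ⊗ₜ v - 1 ⊗ₜ ⁅x, v⁆ := rfl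

theorem span_envelopingRelation :
    Submodule.span (𝒰 R L) {k | ∃ x v, envelopingRelation R V (L := L) x v = k} = ⊤ := by
  set N := Submodule.span (𝒰 R L) {k | ∃ x v, envelopingRelation R V (L := L) x v = k}
  -- Modulo the relations every tensor `a ⊗ v` is congruent to `1 ⊗ a • v`.
  let S : Subalgebra R (𝒰 R L) :=
    { carrier := {a | ∀ v : V, a ⊗ₜ v - 1 ⊗ₜ (a • v) ∈ N.map (LinearMap.ker _).subtype}
      mul_mem' := fun {a b} ha hb v => by
        have h := add_mem (Submodule.smul_mem _ a (hb v)) (ha (b • v))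
        rwa [smul_sub, TensorProduct.smul_tmul', TensorProduct.smul_tmul', smul_eq_mul,
          smul_eq_mul, mul_one, sub_add_sub_cancel, ← mul_smul] at h
      add_mem' := fun {a b} ha hb v => by
        have h := add_mem (ha v) (hb v)
        rwa [sub_add_sub_comm, ← TensorProduct.add_tmul, ← TensorProduct.tmul_add,
          ← add_smul] at h
      algebraMap_mem' := fun r v => by
        rw [algebraMap_smul, Algebra.algebraMap_eq_smul_one, TensorProduct.smul_tmul, sub_self]
        exact zero_mem _ }
  have hS : S = ⊤ := envelopingSubalgebra_eq_top fun x v => by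
    rw [IsEnvelopingModule.ι_smul]
    exact ⟨envelopingRelation R V x v, Submodule.subset_span ⟨x, v, rfl⟩, rfl⟩
  have hN (t : 𝒰 R L ⊗[R] V) :
      t - 1 ⊗ₜ envelopingCover R L V t ∈ N.map (LinearMap.ker _).subtype := by
    induction t with
    | zero => simp
    | tmul a v => rw [envelopingCover_tmul]; exact (hS ▸ Algebra.mem_top : a ∈ S) v
    | add s t hs ht =>
      have h := add_mem hs ht
      rwa [sub_add_sub_comm, ← TensorProduct.tmul_add, ← map_add] at h
  refine eq_top_iff.mpr fun k _ => ?_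
  obtain ⟨k', hk', h⟩ := hN k
  rw [LinearMap.mem_ker.mp k.2, TensorProduct.tmul_zero, sub_zero] at h
  exact Subtype.ext h ▸ hk'

/-- A homomorphism from the kernel of `U(L) ⊗ V → V` to `W`, evaluated on the relations
`x ⊗ v - 1 ⊗ ⁅x, v⁆`, is a derivation of `L` in `Hom(V, W)`. -/
noncomputable def derivationOfKerHom (k : LinearMap.ker (envelopingCover R L V) →ₗ[𝒰 R L] W) :
    LieDerivation R L (V →ₗ[R] W) where
  __ := (envelopingRelation R V).compr₂ (k.restrictScalars R)
  leibniz' x y := by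
    have h (v : V) : envelopingRelation R V ⁅x, y⁆ v =
        ι R x • envelopingRelation R V y v - envelopingRelation R V y ⁅x, v⁆ -
          (ι R y • envelopingRelation R V x v - envelopingRelation R V x ⁅y, v⁆) :=
      Subtype.ext (by
        simp only [coe_envelopingRelation, Submodule.coe_sub, Submodule.coe_smul, smul_sub,
          TensorProduct.smul_tmul', smul_eq_mul, mul_one, LieHom.map_lie,
          LieRing.of_associative_ring_bracket, TensorProduct.sub_tmul, lie_lie,
          TensorProduct.tmul_sub]
        abel)
    ext v
    simp [h, IsEnvelopingModule.ι_smul, -UniversalEnvelopingAlgebra.ι_apply]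

@[simp]
theorem derivationOfKerHom_apply (k : LinearMap.ker (envelopingCover R L V) →ₗ[𝒰 R L] W)
    (x : L) (v : V) : derivationOfKerHom k x v = k (envelopingRelation R V x v) := rfl

theorem derivationOfKerHom_injective :
    Function.Injective
      (derivationOfKerHom : (LinearMap.ker (envelopingCover R L V) →ₗ[𝒰 R L] W) → _) := by
  intro k k' h
  refine LinearMap.ext_on span_envelopingRelation ?_
  rintro _ ⟨x, v, rfl⟩
  rw [← derivationOfKerHom_apply, h, derivationOfKerHom_apply]

theorem exists_comp_subtype_eq_iff (k : LinearMap.ker (envelopingCover R L V) →ₗ[𝒰 R L] W) :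
    (∃ ψ : 𝒰 R L ⊗[R] V →ₗ[𝒰 R L] W, ψ ∘ₗ (LinearMap.ker _).subtype = k) ↔
      derivationOfKerHom k ∈ LinearMap.range (LieDerivation.inner R L (V →ₗ[R] W)) := by
  have key (T : V →ₗ[R] W) : derivationOfKerHom
      (envelopingLift T ∘ₗ (LinearMap.ker (envelopingCover R L V)).subtype) =
        LieDerivation.inner R L (V →ₗ[R] W) T := by
    ext x v
    simp [IsEnvelopingModule.ι_smul, -UniversalEnvelopingAlgebra.ι_apply]
  constructor
  · rintro ⟨ψ, rfl⟩
    obtain ⟨T, rfl⟩ := exists_eq_envelopingLift ψ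
    exact ⟨T, (key T).symm⟩
  · rintro ⟨T, hT⟩
    exact ⟨envelopingLift T, derivationOfKerHom_injective ((key T).trans hT)⟩

theorem derivationOfKerHom_surjective :
    Function.Surjective
      (derivationOfKerHom : (LinearMap.ker (envelopingCover R L V) →ₗ[𝒰 R L] W) → _) := by
  intro D
  let _ : Module (𝒰 R L) (DerivationExtension D) := Module.compHom _
    (UniversalEnvelopingAlgebra.lift R (LieModule.toEnd R L (DerivationExtension D))).toRingHom
  have _ : IsEnvelopingModule R L (DerivationExtension D) := isEnvelopingModule_compHom _
  let G : 𝒰 R L ⊗[R] V →ₗ[𝒰 R L] DerivationExtension D :=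
    envelopingLift (DerivationExtension.inl D)
  have fst_G (t : 𝒰 R L ⊗[R] V) : DerivationExtension.fst D (G t) = envelopingCover R L V t := by
    induction t with
    | zero => simp
    | tmul a v => simp [G, map_enveloping_smul]
    | add s t hs ht => rw [map_add, map_add, map_add, hs, ht]
  let k : LinearMap.ker (envelopingCover R L V) →ₗ[𝒰 R L] W :=
    { toFun := fun y => DerivationExtension.snd D (G y)
      map_add' := fun y y' => by rw [Submodule.coe_add, map_add, map_add]
      map_smul' := fun a y => by
        obtain ⟨w, hw⟩ := (DerivationExtension.fst_eq_zero_iff D _).mp ((fst_G y).trans y.2)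
        rw [Submodule.coe_smul, map_smul, ← hw, ← map_enveloping_smul,
          DerivationExtension.snd_inr, DerivationExtension.snd_inr, RingHom.id_apply] }
  refine ⟨k, LieDerivation.ext fun x => LinearMap.ext fun v => ?_⟩
  change DerivationExtension.snd D (G (ι R x ⊗ₜ v - 1 ⊗ₜ ⁅x, v⁆)) = D x v
  rw [map_sub, envelopingLift_tmul, envelopingLift_tmul, IsEnvelopingModule.ι_smul,
    DerivationExtension.lie_inl, one_smul, add_sub_cancel_left, DerivationExtension.snd_inr]

end CommRing

section Ext

variable {K C : Type*} [CommRing K] [Category C] [Abelian C] [HasExt C] [Linear K C]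
  {S : ShortComplex C}

variable (K) in
/-- The connecting map `Hom(X₁, Y) → Ext¹(X₃, Y)` of a short exact sequence. -/
noncomputable def extConnectingHom (hS : S.ShortExact) (Y : C) :
    (S.X₁ ⟶ Y) →ₗ[K] Ext S.X₃ Y 1 :=
  hS.extClass.precompOfLinear K Y (add_zero 1) ∘ₗ (Ext.linearEquiv₀ (R := K)).symm.toLinearMap

theorem extConnectingHom_apply (hS : S.ShortExact) (Y : C) (f : S.X₁ ⟶ Y) :
    extConnectingHom K hS Y f = hS.extClass.comp (Ext.mk₀ f) (add_zero 1) := by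
  simp [extConnectingHom]

theorem extConnectingHom_eq_zero_iff (hS : S.ShortExact) (Y : C) (f : S.X₁ ⟶ Y) :
    extConnectingHom K hS Y f = 0 ↔ ∃ g : S.X₂ ⟶ Y, S.f ≫ g = f := by
  rw [extConnectingHom_apply]
  constructor
  · intro h
    obtain ⟨y, hy⟩ := Ext.contravariant_sequence_exact₁ hS Y (Ext.mk₀ f) (add_zero 1) h
    refine ⟨Ext.linearEquiv₀ (R := K) y, (Ext.linearEquiv₀ (R := K)).symm.injective ?_⟩
    simp only [Ext.linearEquiv₀_symm_apply, ← hy, ← Ext.mk₀_comp_mk₀, Ext.mk₀_linearEquiv₀_apply]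
  · rintro ⟨g, rfl⟩
    simp [← Ext.mk₀_comp_mk₀]

theorem extConnectingHom_surjective (hS : S.ShortExact) (Y : C) [Projective S.X₂] :
    Function.Surjective (extConnectingHom K hS Y) := by
  intro x
  obtain ⟨y, hy⟩ := Ext.contravariant_sequence_exact₃ hS Y x (Ext.eq_zero_of_projective _)
    (add_zero 1)
  exact ⟨Ext.linearEquiv₀ (R := K) y,
    by rw [extConnectingHom_apply, Ext.mk₀_linearEquiv₀_apply, hy]⟩

theorem nonempty_ext_linearEquiv_of_surjective (hS : S.ShortExact) (Y : C) [Projective S.X₂]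
    {Q : Type*} [AddCommGroup Q] [Module K Q] (Δ : (S.X₁ ⟶ Y) →ₗ[K] Q)
    (hΔ : Function.Surjective Δ) (hker : ∀ f, Δ f = 0 ↔ ∃ g : S.X₂ ⟶ Y, S.f ≫ g = f) :
    Nonempty (Ext S.X₃ Y 1 ≃ₗ[K] Q) := by
  have hker' : LinearMap.ker (extConnectingHom K hS Y) = LinearMap.ker Δ := by
    ext f
    rw [LinearMap.mem_ker, LinearMap.mem_ker, extConnectingHom_eq_zero_iff, hker]
  exact ⟨((extConnectingHom K hS Y).quotKerEquivOfSurjective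
    (extConnectingHom_surjective hS Y)).symm ≪≫ₗ
    Submodule.quotEquivOfEq _ _ hker' ≪≫ₗ Δ.quotKerEquivOfSurjective hΔ⟩

end Ext

variable {K : Type u} {L : Type v} [Field K] [LieRing L] [LieAlgebra K L]
  {V W : Type (max u v w)}
  [AddCommGroup V] [Module K V] [LieRingModule L V] [LieModule K L V] [Module (𝒰 K L) V]
  [IsEnvelopingModule K L V]
  [AddCommGroup W] [Module K W] [LieRingModule L W] [LieModule K L W] [Module (𝒰 K L) W]
  [IsEnvelopingModule K L W]

theorem nonempty_ext_linearEquiv_outerDerivations :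
    Nonempty (Ext (ModuleCat.of (𝒰 K L) V) (ModuleCat.of (𝒰 K L) W) 1 ≃ₗ[K]
      OuterDerivations K L (V →ₗ[K] W)) := by
  have hS := LinearMap.shortExact_shortComplexKer
    (envelopingCover_surjective (R := K) (L := L) (V := V))
  have : Projective (envelopingCover K L V).shortComplexKer.X₂ :=
    inferInstanceAs (Projective (ModuleCat.of (𝒰 K L) (𝒰 K L ⊗[K] V)))
  -- `K` also acts on these homomorphisms through its action on `W`, which agrees only
  -- propositionally with the action through `U(L)` that `Ext` carries.
  let _ : Module K (ModuleCat.of (𝒰 K L) (LinearMap.ker (envelopingCover K L V)) ⟶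
      ModuleCat.of (𝒰 K L) W) := Linear.homModule _ _
  let Δ : (ModuleCat.of (𝒰 K L) (LinearMap.ker (envelopingCover K L V)) ⟶
      ModuleCat.of (𝒰 K L) W) →ₗ[K] OuterDerivations K L (V →ₗ[K] W) :=
    { toFun := fun k => Submodule.Quotient.mk (derivationOfKerHom k.hom)
      map_add' := fun _ _ => rfl
      map_smul' := fun c k => congrArg Submodule.Quotient.mk (LieDerivation.ext fun x =>
        LinearMap.ext fun v => algebraMap_smul (𝒰 K L) c (k.hom (envelopingRelation K V x v))) }
  refine nonempty_ext_linearEquiv_of_surjective hS (ModuleCat.of (𝒰 K L) W) Δ (fun d => ?_)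
    fun k => ?_
  · obtain ⟨D, rfl⟩ := Submodule.Quotient.mk_surjective _ d
    obtain ⟨k, rfl⟩ := derivationOfKerHom_surjective D
    exact ⟨ModuleCat.ofHom k, rfl⟩
  · refine (Submodule.Quotient.mk_eq_zero _).trans
      ((exists_comp_subtype_eq_iff k.hom).symm.trans ?_)
    exact ⟨fun ⟨ψ, hψ⟩ => ⟨ModuleCat.ofHom ψ, ModuleCat.hom_ext hψ⟩,
      fun ⟨ψ, hψ⟩ => ⟨ψ.hom, congrArg ModuleCat.Hom.hom hψ⟩⟩

end EnvelopingExt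

section EigenvectorSpan

variable {K M : Type*} [Field K] [AddCommGroup M] [Module K M] {T : Module.End K M} {S : Set M}

theorem mem_span_inter_eigenspace (hS : ∀ s ∈ S, ∃ μ, s ∈ T.eigenspace μ) {x : M}
    (hx : x ∈ Submodule.span K S) {τ : K} (hτ : x ∈ T.eigenspace τ) :
    x ∈ Submodule.span K (S ∩ T.eigenspace τ) := by
  rw [← Set.inter_union_sdiff S (T.eigenspace τ : Set M), Submodule.span_union] at hx
  obtain ⟨y, hy, z, hz, rfl⟩ := Submodule.mem_sup.mp hx
  have hyτ : y ∈ T.eigenspace τ := Submodule.span_le.mpr Set.inter_subset_right hy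
  have hzτ : z ∈ T.eigenspace τ := (Submodule.add_mem_iff_right _ hyτ).mp hτ
  have hz' : z ∈ ⨆ μ, ⨆ (_ : μ ≠ τ), T.eigenspace μ := by
    refine Submodule.span_le.mpr (fun s hs => ?_) hz
    obtain ⟨μ, hμ⟩ := hS s hs.1
    exact Submodule.mem_iSup_of_mem μ
      (Submodule.mem_iSup_of_mem (fun h => hs.2 (h ▸ hμ)) hμ)
  rwa [Submodule.disjoint_def.mp (T.eigenspaces_iSupIndep τ) z hzτ hz', add_zero]

theorem eigenspace_sup_range_eq_top (hS : ∀ s ∈ S, ∃ μ, s ∈ T.eigenspace μ)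
    (hspan : Submodule.span K S = ⊤) (τ : K) :
    T.eigenspace τ ⊔ LinearMap.range (T - τ • 1) = ⊤ := by
  rw [eq_top_iff, ← hspan, Submodule.span_le]
  intro s hs
  obtain ⟨μ, hμ⟩ := hS s hs
  by_cases hμτ : μ = τ
  · exact Submodule.mem_sup_left (hμτ ▸ hμ)
  · refine Submodule.mem_sup_right ⟨(μ - τ)⁻¹ • s, ?_⟩
    rw [map_smul, LinearMap.sub_apply, Module.End.mem_eigenspace_iff.mp hμ,
      LinearMap.smul_apply, Module.End.one_apply, ← sub_smul, inv_smul_smul₀ (sub_ne_zero.mpr hμτ)]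

end EigenvectorSpan

section Sl2

open LieModule Polynomial

variable {L M : Type*} [LieRing L] [LieAlgebra ℂ L] [AddCommGroup M] [Module ℂ M]
  [LieRingModule L M] [LieModule ℂ L M] {e h f : L}

variable (M)

theorem toEnd_mul_toEnd (x y : L) :
    toEnd ℂ L M x * toEnd ℂ L M y = toEnd ℂ L M y * toEnd ℂ L M x + toEnd ℂ L M ⁅x, y⁆ := by
  ext v
  simp only [Module.End.mul_apply, LinearMap.add_apply, toEnd_apply_apply, leibniz_lie x y v,
    add_comm]

variable (e h f) in
/-- The Casimir operator `h² + 2h + 4fe` of an `sl₂`-triple, perturbed by `i h`: its eigenvalue on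
a vector of an irreducible module determines both the highest weight and the weight. -/
noncomputable def twistedCasimir : Module.End ℂ M :=
  toEnd ℂ L M h ^ 2 + (2 + Complex.I) • toEnd ℂ L M h + (4 : ℂ) • (toEnd ℂ L M f * toEnd ℂ L M e)

/-- The eigenvalue of `twistedCasimir` on `f ^ j • u`, for `u` of highest weight `n`. The value
`j = -1`, which does not occur, is that of the image under `e` of a highest weight vector. -/
noncomputable def twistedCasimirValue (n : ℕ) (j : ℤ) : ℂ := n * (n + 2) + (n - 2 * j) * Complex.I

theorem semiconjBy_toEnd_e_twistedCasimir_sub (t : IsSl2Triple h e f) (n : ℕ) (j : ℤ) :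
    SemiconjBy (toEnd ℂ L M e) (twistedCasimir M e h f - twistedCasimirValue n j • 1)
      (twistedCasimir M e h f - twistedCasimirValue n (j - 1) • 1) := by
  have he := toEnd_mul_toEnd M h e
  have hf := toEnd_mul_toEnd M e f
  have hj : twistedCasimirValue n (j - 1) = twistedCasimirValue n j + 2 * Complex.I := by
    simp only [twistedCasimirValue, Int.cast_sub, Int.cast_one]
    ring
  rw [t.lie_h_e_nsmul, map_nsmul] at he
  rw [t.lie_e_f] at hf
  rw [SemiconjBy, hj, twistedCasimir]
  generalize toEnd ℂ L M h = H at *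
  generalize toEnd ℂ L M e = E at *
  generalize toEnd ℂ L M f = F at *
  linear_combination (norm := skip) (4 : ℂ) • (hf * E) - H * he - he * H - Complex.I • he
  simp only [pow_two, two_mul, mul_add, mul_sub, add_mul, sub_mul, mul_assoc, smul_add,
    smul_mul_assoc, mul_smul_comm, mul_one, one_mul]
  module

theorem semiconjBy_toEnd_f_twistedCasimir_sub (t : IsSl2Triple h e f) (n : ℕ) (j : ℤ) :
    SemiconjBy (toEnd ℂ L M f) (twistedCasimir M e h f - twistedCasimirValue n j • 1)
      (twistedCasimir M e h f - twistedCasimirValue n (j + 1) • 1) := by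
  have hf := toEnd_mul_toEnd M h f
  have he := toEnd_mul_toEnd M e f
  have hj : twistedCasimirValue n (j + 1) = twistedCasimirValue n j - 2 * Complex.I := by
    simp only [twistedCasimirValue, Int.cast_add, Int.cast_one]
    ring
  rw [t.lie_h_f_nsmul, map_neg, map_nsmul] at hf
  rw [t.lie_e_f] at he
  rw [SemiconjBy, hj, twistedCasimir]
  generalize toEnd ℂ L M h = H at *
  generalize toEnd ℂ L M e = E at *
  generalize toEnd ℂ L M f = F at *
  linear_combination (norm := skip) -(H * hf) - hf * H - (4 : ℂ) • (F * he) - Complex.I • hf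
  simp only [pow_two, two_mul, mul_add, mul_sub, add_mul, sub_mul, mul_assoc, smul_add,
    smul_mul_assoc, mul_smul_comm, mul_one, one_mul, mul_neg, neg_mul, smul_neg]
  module

variable (e h) in
/-- The vectors killed by `e` on which `h` acts by `μ`. -/
def highestWeightSpace (μ : ℂ) : Submodule ℂ M :=
  LinearMap.ker (toEnd ℂ L M e) ⊓ (toEnd ℂ L M h).eigenspace μ

variable (e h f) in
/-- The vectors `f ^ i • u`, where `u` is a highest weight vector of natural weight. -/
def stringVectors : Set M :=
  {w | ∃ (n : ℕ) (i : ℕ), ∃ u ∈ highestWeightSpace M e h n, (toEnd ℂ L M f ^ i) u = w}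

variable {M}

theorem mem_highestWeightSpace {μ : ℂ} {w : M} :
    w ∈ highestWeightSpace M e h μ ↔ ⁅e, w⁆ = 0 ∧ ⁅h, w⁆ = μ • w := by
  rw [highestWeightSpace, Submodule.mem_inf, LinearMap.mem_ker, Module.End.mem_eigenspace_iff,
    toEnd_apply_apply, toEnd_apply_apply]

theorem twistedCasimirValue_inj {m n : ℕ} {i j : ℤ} :
    twistedCasimirValue m i = twistedCasimirValue n j ↔ m = n ∧ i = j := by
  refine ⟨fun hmn => ?_, by rintro ⟨rfl, rfl⟩; rfl⟩
  have hre := congrArg Complex.re hmn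
  have him := congrArg Complex.im hmn
  simp only [twistedCasimirValue, Complex.add_re, Complex.mul_re, Complex.natCast_re,
    Complex.re_ofNat, Complex.natCast_im, Complex.add_im, Complex.im_ofNat, add_zero, mul_zero,
    sub_zero, Complex.sub_re, Complex.intCast_re, Complex.intCast_im, Complex.I_re, Complex.sub_im,
    Complex.mul_im, zero_mul, sub_self, Complex.I_im, mul_one, zero_add] at hre him
  norm_cast at hre him
  have : m = n := by nlinarith
  have : (m : ℤ) - 2 * i = n - 2 * j :=
    (Int.cast_inj (α := ℝ)).mp (by push_cast; exact him)
  omega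

theorem twistedCasimir_apply_of_lie_e_eq_zero {w : M} (hw : ⁅e, w⁆ = 0) :
    twistedCasimir M e h f w = aeval (toEnd ℂ L M h) (X * (X + C (2 + Complex.I))) w := by
  simp [twistedCasimir, hw, pow_two, add_smul]

theorem pow_toEnd_f_mem_eigenspace_twistedCasimir (t : IsSl2Triple h e f) {n : ℕ} {u : M}
    (hu : u ∈ highestWeightSpace M e h n) (i : ℕ) :
    (toEnd ℂ L M f ^ i) u ∈ (twistedCasimir M e h f).eigenspace (twistedCasimirValue n i) := by
  rw [Module.End.mem_eigenspace_iff]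
  induction i with
  | zero =>
    obtain ⟨he, hh⟩ := mem_highestWeightSpace.mp hu
    simp only [pow_zero, Module.End.one_apply, twistedCasimir_apply_of_lie_e_eq_zero he, map_add,
      map_mul, aeval_X, aeval_C, Module.End.mul_apply, LinearMap.add_apply, toEnd_apply_apply, hh,
      Module.algebraMap_end_apply, lie_smul, twistedCasimirValue, Nat.cast_zero, Int.cast_zero,
      mul_zero, sub_zero]
    module
  | succ i ih =>
    have := LinearMap.congr_fun (semiconjBy_toEnd_f_twistedCasimir_sub M t n i)
      ((toEnd ℂ L M f ^ i) u)
    rw [Module.End.mul_apply, LinearMap.sub_apply, ih, LinearMap.smul_apply, Module.End.one_apply,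
      sub_self, map_zero] at this
    rw [pow_succ', Nat.cast_succ]
    exact sub_eq_zero.mp this.symm

theorem mem_eigenspace_twistedCasimir (t : IsSl2Triple h e f) {n : ℕ} {u : M}
    (hu : u ∈ highestWeightSpace M e h n) :
    u ∈ (twistedCasimir M e h f).eigenspace (twistedCasimirValue n 0) := by
  simpa using pow_toEnd_f_mem_eigenspace_twistedCasimir t hu 0

theorem exists_mem_eigenspace_of_mem_stringVectors (t : IsSl2Triple h e f) {w : M}
    (hw : w ∈ stringVectors M e h f) : ∃ μ, w ∈ (twistedCasimir M e h f).eigenspace μ := by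
  obtain ⟨n, i, u, hu, rfl⟩ := hw
  exact ⟨_, pow_toEnd_f_mem_eigenspace_twistedCasimir t hu i⟩

theorem exists_pow_toEnd_f_eq_of_mem_eigenspace (t : IsSl2Triple h e f) {n : ℕ} {j : ℤ} {w : M}
    (hw : w ∈ stringVectors M e h f) (hw0 : w ≠ 0)
    (hT : w ∈ (twistedCasimir M e h f).eigenspace (twistedCasimirValue n j)) :
    ∃ i : ℕ, i = j ∧ ∃ u ∈ highestWeightSpace M e h n, (toEnd ℂ L M f ^ i) u = w := by
  obtain ⟨m, i, u, hu, rfl⟩ := hw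
  have hi := pow_toEnd_f_mem_eigenspace_twistedCasimir t hu i
  rw [Module.End.mem_eigenspace_iff] at hi hT
  obtain ⟨rfl, hij⟩ := twistedCasimirValue_inj.mp (smul_left_injective ℂ hw0 (hi.symm.trans hT))
  exact ⟨i, hij, u, hu, rfl⟩

theorem mem_span_inter_highestWeightSpace (t : IsSl2Triple h e f) {Y : Set M}
    (hY : Y ⊆ stringVectors M e h f) {n : ℕ} {x : M} (hx : x ∈ Submodule.span ℂ Y)
    (hn : x ∈ highestWeightSpace M e h n) :
    x ∈ Submodule.span ℂ (Y ∩ highestWeightSpace M e h n) := by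
  have hT := mem_eigenspace_twistedCasimir t hn
  refine Submodule.span_le.mpr (fun y hy => ?_) (mem_span_inter_eigenspace
    (fun y hy => exists_mem_eigenspace_of_mem_stringVectors t (hY hy)) hx hT)
  by_cases hy0 : y = 0
  · exact hy0 ▸ zero_mem _
  obtain ⟨i, hi, u, hu, rfl⟩ := exists_pow_toEnd_f_eq_of_mem_eigenspace t (hY hy.1) hy0 hy.2
  obtain rfl : i = 0 := by simpa using hi
  exact Submodule.subset_span ⟨hy.1, hu⟩

theorem eigenspace_twistedCasimir_neg_one_eq_bot (t : IsSl2Triple h e f)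
    (hspan : Submodule.span ℂ (stringVectors M e h f) = ⊤) (n : ℕ) :
    (twistedCasimir M e h f).eigenspace (twistedCasimirValue n (-1)) = ⊥ := by
  refine eq_bot_iff.mpr fun x hx => ?_
  refine Submodule.span_le.mpr (fun w hw => ?_) (mem_span_inter_eigenspace
    (fun w => exists_mem_eigenspace_of_mem_stringVectors t) (hspan ▸ Submodule.mem_top) hx)
  by_contra hw0
  obtain ⟨i, hi, -⟩ := exists_pow_toEnd_f_eq_of_mem_eigenspace t hw.1 hw0 hw.2
  omega

theorem lie_h_pow_toEnd_f (t : IsSl2Triple h e f) (w : M) (k : ℕ) :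
    ⁅h, (toEnd ℂ L M f ^ k) w⁆ = (toEnd ℂ L M f ^ k) (⁅h, w⁆ - (2 * k : ℂ) • w) := by
  induction k with
  | zero => simp
  | succ k ih =>
    rw [pow_succ', Module.End.mul_apply, toEnd_apply_apply, leibniz_lie, t.lie_lie_smul_f ℂ, ih,
      Module.End.mul_apply, toEnd_apply_apply, neg_lie, smul_lie, ← lie_smul, ← map_smul,
      ← lie_neg, ← map_neg, ← lie_add, ← map_add]
    push_cast
    congr 2
    module

theorem lie_e_pow_succ_toEnd_f (t : IsSl2Triple h e f) {w : M} (hw : ⁅e, w⁆ = 0) (k : ℕ) :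
    ⁅e, (toEnd ℂ L M f ^ (k + 1)) w⁆ =
      (k + 1 : ℂ) • (toEnd ℂ L M f ^ k) (⁅h, w⁆ - (k : ℂ) • w) := by
  induction k with
  | zero => simp [leibniz_lie e, t.lie_e_f, hw]
  | succ k ih =>
    rw [pow_succ', Module.End.mul_apply, toEnd_apply_apply, leibniz_lie, t.lie_e_f, ih,
      lie_h_pow_toEnd_f t, pow_succ' _ k]
    push_cast
    rw [Module.End.mul_apply, Module.End.mul_apply]
    simp only [map_sub, map_smul, toEnd_apply_apply, lie_sub, lie_smul]
    module

theorem aeval_prod_eq_zero_of_pow_toEnd_f_eq_zero (t : IsSl2Triple h e f) {w : M}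
    (hw : ⁅e, w⁆ = 0) {N : ℕ} (hN : (toEnd ℂ L M f ^ N) w = 0) :
    aeval (toEnd ℂ L M h) (∏ j ∈ Finset.range N, (X - C (j : ℂ))) w = 0 := by
  induction N generalizing w with
  | zero => simpa using hN
  | succ N ih =>
    rw [Finset.prod_range_succ, map_mul, Module.End.mul_apply]
    have hw' : aeval (toEnd ℂ L M h) (X - C (N : ℂ)) w = ⁅h, w⁆ - (N : ℂ) • w := by
      simp [Nat.cast_smul_eq_nsmul]
    rw [hw']
    refine ih ?_ ?_
    · rw [lie_sub, lie_smul, leibniz_lie, ← lie_skew, t.lie_h_e_nsmul, neg_lie, nsmul_lie, hw]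
      simp
    · have := lie_e_pow_succ_toEnd_f t hw N
      rw [hN, lie_zero] at this
      exact (smul_eq_zero.mp this.symm).resolve_left (Nat.cast_add_one_ne_zero N)

variable (M e h f) in
/-- An integrable module over an `sl₂`-triple: it is spanned by the vectors of the strings
`u, f • u, f ^ 2 • u, …` through highest weight vectors `u`, and `f` is locally nilpotent on it. -/
structure IsIntegrable : Prop where
  span_stringVectors : Submodule.span ℂ (stringVectors M e h f) = ⊤
  exists_pow_toEnd_f_eq_zero (w : M) : ∃ N : ℕ, (toEnd ℂ L M f ^ N) w = 0

theorem exists_nat_of_mem_highestWeightSpace (t : IsSl2Triple h e f) (hM : IsIntegrable M e h f)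
    {μ : ℂ} {u : M} (hu : u ∈ highestWeightSpace M e h μ) (hu0 : u ≠ 0) : ∃ n : ℕ, μ = n := by
  obtain ⟨N, hN⟩ := hM.exists_pow_toEnd_f_eq_zero u
  have := aeval_prod_eq_zero_of_pow_toEnd_f_eq_zero t (mem_highestWeightSpace.mp hu).1 hN
  rw [Module.End.aeval_apply_of_hasEigenvector ⟨hu.2, hu0⟩, smul_eq_zero, or_iff_left hu0,
    eval_prod, Finset.prod_eq_zero_iff] at this
  obtain ⟨n, -, hn⟩ := this
  exact ⟨n, by simpa [sub_eq_zero] using hn⟩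

theorem twistedCasimir_sub_apply_eq_aeval {w : M} (hw : ⁅e, w⁆ = 0) (n : ℕ) :
    (twistedCasimir M e h f - twistedCasimirValue n 0 • 1) w =
      aeval (toEnd ℂ L M h) ((X - C (n : ℂ)) * (X - C (-(n + 2 + Complex.I)))) w := by
  have hP : (X - C (n : ℂ)) * (X - C (-(n + 2 + Complex.I))) =
      X * (X + C (2 + Complex.I)) - C (twistedCasimirValue n 0) := by
    simp only [map_natCast, neg_add_rev, map_add, map_neg, twistedCasimirValue, Int.cast_zero,
      mul_zero, sub_zero, map_mul]
    ring
  rw [LinearMap.sub_apply, twistedCasimir_apply_of_lie_e_eq_zero hw, hP, map_sub, aeval_C,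
    LinearMap.sub_apply, Algebra.algebraMap_eq_smul_one]

theorem mem_highestWeightSpace_of_twistedCasimir (t : IsSl2Triple h e f) {w : M} (hw : ⁅e, w⁆ = 0)
    {N : ℕ} (hN : (toEnd ℂ L M f ^ N) w = 0) {n : ℕ}
    (hT : w ∈ LinearMap.ker ((twistedCasimir M e h f - twistedCasimirValue n 0 • 1) ^ 2)) :
    w ∈ highestWeightSpace M e h n := by
  let P : ℂ[X] := X - C (-(n + 2 + Complex.I))
  let Q : ℂ[X] := ∏ j ∈ (Finset.range N).erase n, (X - C (j : ℂ))
  have hQ : aeval (toEnd ℂ L M h) (Q * (X - C (n : ℂ))) w = 0 := by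
    have hdvd : ∏ j ∈ Finset.range N, (X - C (j : ℂ)) ∣ Q * (X - C (n : ℂ)) := by
      by_cases hn : n ∈ Finset.range N
      · rw [Finset.prod_erase_mul _ _ hn]
      · simp only [Q, Finset.erase_eq_of_notMem hn, dvd_mul_right]
    obtain ⟨R, hR⟩ := hdvd
    rw [hR, mul_comm, map_mul, Module.End.mul_apply,
      aeval_prod_eq_zero_of_pow_toEnd_f_eq_zero t hw hN, map_zero]
  have hP : aeval (toEnd ℂ L M h) ((X - C (n : ℂ)) * P ^ 2 * (X - C (n : ℂ))) w = 0 := by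
    have hTw : ⁅e, (twistedCasimir M e h f - twistedCasimirValue n 0 • 1) w⁆ = 0 := by
      have := LinearMap.congr_fun (semiconjBy_toEnd_e_twistedCasimir_sub M t n 0) w
      rwa [Module.End.mul_apply, Module.End.mul_apply, toEnd_apply_apply, toEnd_apply_apply, hw,
        map_zero] at this
    have hsq : (X - C (n : ℂ)) * P ^ 2 * (X - C (n : ℂ)) =
        ((X - C (n : ℂ)) * P) * ((X - C (n : ℂ)) * P) := by ring
    rw [hsq, map_mul, Module.End.mul_apply, ← twistedCasimir_sub_apply_eq_aeval hw,
      ← twistedCasimir_sub_apply_eq_aeval hTw, ← Module.End.mul_apply, ← pow_two]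
    exact hT
  have hcop : IsCoprime Q ((X - C (n : ℂ)) * P ^ 2) := by
    refine IsCoprime.prod_left fun j hj => .mul_right ?_ (.pow_right ?_) <;>
      refine isCoprime_X_sub_C_of_isUnit_sub (IsUnit.mk0 _ fun hj0 => ?_)
    · exact Finset.ne_of_mem_erase hj (Nat.cast_injective (sub_eq_zero.mp hj0))
    · simpa using congrArg Complex.im hj0
  rw [map_mul, Module.End.mul_apply] at hQ hP
  have := Submodule.disjoint_def.mp (disjoint_ker_aeval_of_isCoprime (toEnd ℂ L M h) hcop) _ hQ hP
  exact mem_highestWeightSpace.mpr ⟨hw, by simpa [sub_eq_zero, Nat.cast_smul_eq_nsmul] using this⟩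

section Extension

variable {A B C : Type*} [AddCommGroup A] [Module ℂ A] [LieRingModule L A] [LieModule ℂ L A]
  [AddCommGroup B] [Module ℂ B] [LieRingModule L B] [LieModule ℂ L B]
  [AddCommGroup C] [Module ℂ C] [LieRingModule L C] [LieModule ℂ L C]
  {ι : A →ₗ⁅ℂ,L⁆ B} {π : B →ₗ⁅ℂ,L⁆ C}

theorem map_twistedCasimir (φ : A →ₗ⁅ℂ,L⁆ B) (a : A) :
    φ (twistedCasimir A e h f a) = twistedCasimir B e h f (φ a) := by
  simp [twistedCasimir, pow_two]

theorem exists_pow_toEnd_eq_zero_of_exact (hexact : Function.Exact ι π) {x : L}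
    (hA : ∀ a : A, ∃ N : ℕ, (toEnd ℂ L A x ^ N) a = 0)
    (hC : ∀ c : C, ∃ N : ℕ, (toEnd ℂ L C x ^ N) c = 0) (b : B) :
    ∃ N : ℕ, (toEnd ℂ L B x ^ N) b = 0 := by
  obtain ⟨N, hN⟩ := hC (π b)
  rw [toEnd_pow_apply_map] at hN
  obtain ⟨a, ha⟩ := (hexact _).mp hN
  obtain ⟨N', hN'⟩ := hA a
  refine ⟨N' + N, ?_⟩
  rw [pow_add, Module.End.mul_apply, ← ha, toEnd_pow_apply_map, hN', map_zero]

theorem exists_mem_ker_twistedCasimir_sub_sq (hexact : Function.Exact ι π)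
    (hπ : Function.Surjective π) (t : IsSl2Triple h e f) (hA : IsIntegrable A e h f) {τ : ℂ}
    {c : C} (hc : c ∈ (twistedCasimir C e h f).eigenspace τ) :
    ∃ b ∈ LinearMap.ker ((twistedCasimir B e h f - τ • 1) ^ 2), π b = c := by
  obtain ⟨b, rfl⟩ := hπ c
  rw [Module.End.mem_eigenspace_iff, ← map_twistedCasimir, ← sub_eq_zero, ← map_smul,
    ← map_sub] at hc
  obtain ⟨a, ha⟩ := (hexact _).mp hc
  have htop := eigenspace_sup_range_eq_top
    (fun w => exists_mem_eigenspace_of_mem_stringVectors t) hA.span_stringVectors τ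
  obtain ⟨y, hy, _, ⟨x, rfl⟩, rfl⟩ := Submodule.mem_sup.mp (htop ▸ Submodule.mem_top : a ∈ _)
  rw [Module.End.mem_eigenspace_iff] at hy
  refine ⟨b - ι x, ?_, by rw [map_sub, hexact.apply_apply_eq_zero, sub_zero]⟩
  have hb : (twistedCasimir B e h f - τ • 1) (b - ι x) = ι y := by
    simp only [map_add, LinearMap.sub_apply, LinearMap.smul_apply, Module.End.one_apply, map_sub,
      map_smul, map_twistedCasimir] at ha ⊢
    rw [← ha]
    module
  rw [LinearMap.mem_ker, pow_two, Module.End.mul_apply, hb, LinearMap.sub_apply,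
    ← map_twistedCasimir, hy, map_smul, LinearMap.smul_apply, Module.End.one_apply, sub_self]

theorem map_mem_highestWeightSpace (φ : A →ₗ⁅ℂ,L⁆ B) {μ : ℂ} {a : A}
    (ha : a ∈ highestWeightSpace A e h μ) : φ a ∈ highestWeightSpace B e h μ := by
  rw [mem_highestWeightSpace] at ha ⊢
  rw [← LieModuleHom.map_lie, ← LieModuleHom.map_lie, ha.1, ha.2, map_zero, map_smul]
  exact ⟨rfl, rfl⟩

theorem map_mem_stringVectors (φ : A →ₗ⁅ℂ,L⁆ B) {w : A} (hw : w ∈ stringVectors A e h f) :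
    φ w ∈ stringVectors B e h f := by
  obtain ⟨n, i, u, hu, rfl⟩ := hw
  exact ⟨n, i, φ u, map_mem_highestWeightSpace φ hu, toEnd_pow_apply_map φ i f u⟩

theorem exists_mem_highestWeightSpace_of_exact (hι : Function.Injective ι)
    (hexact : Function.Exact ι π) (hπ : Function.Surjective π) (t : IsSl2Triple h e f)
    (hA : IsIntegrable A e h f) (hC : ∀ c : C, ∃ N : ℕ, (toEnd ℂ L C f ^ N) c = 0) {n : ℕ} {c : C}
    (hc : c ∈ highestWeightSpace C e h n) : ∃ b ∈ highestWeightSpace B e h n, π b = c := by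
  obtain ⟨b, hb, rfl⟩ := exists_mem_ker_twistedCasimir_sub_sq hexact hπ t hA
    (mem_eigenspace_twistedCasimir t hc)
  obtain ⟨a, ha⟩ := (hexact ⁅e, b⁆).mp <| by
    rw [LieModuleHom.map_lie, (mem_highestWeightSpace.mp hc).1]
  have ha0 : a = 0 := by
    have hker := eigenspace_twistedCasimir_neg_one_eq_bot t hA.span_stringVectors n
    rw [Module.End.eigenspace_def] at hker
    refine LinearMap.ker_eq_bot'.mp hker _ (LinearMap.ker_eq_bot'.mp hker _ (hι ?_))
    have := LinearMap.congr_fun ((semiconjBy_toEnd_e_twistedCasimir_sub B t n 0).pow_right 2) b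
    rw [Module.End.mul_apply, LinearMap.mem_ker.mp hb, map_zero, Module.End.mul_apply,
      toEnd_apply_apply, ← ha] at this
    simpa [pow_two, map_twistedCasimir] using this.symm
  rw [ha0, map_zero] at ha
  obtain ⟨N, hN⟩ := exists_pow_toEnd_eq_zero_of_exact hexact hA.exists_pow_toEnd_f_eq_zero hC b
  exact ⟨b, mem_highestWeightSpace_of_twistedCasimir t ha.symm hN hb, rfl⟩

end Extension

section FiniteDimensional

theorem isIntegrable_of_iSup_eq_top {ι : Type*} {W : ι → LieSubmodule ℂ L M}
    (hW : ∀ i, IsIntegrable (W i) e h f) (htop : ⨆ i, (W i).toSubmodule = ⊤) :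
    IsIntegrable M e h f where
  span_stringVectors := by
    rw [eq_top_iff, ← htop, iSup_le_iff]
    intro i w hw
    have hwi : (⟨w, hw⟩ : W i) ∈ Submodule.span ℂ (stringVectors (W i) e h f) :=
      (hW i).span_stringVectors ▸ Submodule.mem_top
    have := Submodule.mem_map_of_mem (f := ((W i).incl : W i →ₗ[ℂ] M)) hwi
    rw [Submodule.map_span] at this
    refine Submodule.span_mono ?_ this
    rintro _ ⟨s, hs, rfl⟩
    exact map_mem_stringVectors (W i).incl hs
  exists_pow_toEnd_f_eq_zero := by
    have hle : ⨆ i, (W i).toSubmodule ≤ (toEnd ℂ L M f).maxGenEigenspace 0 := by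
      refine iSup_le fun i w hw => ?_
      obtain ⟨N, hN⟩ := (hW i).exists_pow_toEnd_f_eq_zero ⟨w, hw⟩
      rw [Module.End.mem_maxGenEigenspace, zero_smul, sub_zero]
      exact ⟨N, by simpa [hN] using toEnd_pow_apply_map (W i).incl N f ⟨w, hw⟩⟩
    intro w
    have hw := hle (htop ▸ Submodule.mem_top : w ∈ _)
    rwa [Module.End.mem_maxGenEigenspace, zero_smul, sub_zero] at hw

theorem isIntegrable_of_isIrreducible [FiniteDimensional ℂ M] [LieModule.IsIrreducible ℂ L M]
    (t : IsSl2Triple h e f) (hspan : Submodule.span ℂ {e, h, f} = ⊤) : IsIntegrable M e h f := by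
  have := LieModule.nontrivial_of_isIrreducible ℂ L M
  obtain ⟨μ, u, -, hu⟩ := t.exists_hasPrimitiveVectorWith (R := ℂ) (M := M)
  obtain ⟨n, rfl⟩ := hu.exists_nat
  let Y : Set M := Set.range fun i => (toEnd ℂ L M f ^ i) u
  have hY : ∀ x ∈ ({e, h, f} : Set L), ∀ y ∈ Y, ⁅x, y⁆ ∈ Submodule.span ℂ Y := by
    have hmem (i : ℕ) (c : ℂ) : c • (toEnd ℂ L M f ^ i) u ∈ Submodule.span ℂ Y :=
      Submodule.smul_mem _ _ (Submodule.subset_span ⟨i, rfl⟩)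
    rintro x (rfl | rfl | rfl) _ ⟨i, rfl⟩
    · cases i with
      | zero => simp [hu.lie_e]
      | succ i => simpa only [hu.lie_e_pow_succ_toEnd_f] using hmem i _
    · simpa only [hu.lie_h_pow_toEnd_f] using hmem i _
    · simpa only [hu.lie_f_pow_toEnd_f, one_smul] using hmem (i + 1) 1
  have htop : Submodule.span ℂ Y = ⊤ := by
    refine congrArg LieSubmodule.toSubmodule
      ((eq_bot_or_eq_top (spanLieSubmodule hspan hY)).resolve_left fun hbot => hu.ne_zero ?_)
    exact (LieSubmodule.eq_bot_iff _).mp hbot u (Submodule.subset_span ⟨0, rfl⟩)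
  constructor
  · refine eq_top_iff.mpr (htop.symm.trans_le (Submodule.span_mono ?_))
    rintro _ ⟨i, rfl⟩
    exact ⟨n, i, u, mem_highestWeightSpace.mpr ⟨hu.lie_e, hu.lie_h⟩, rfl⟩
  · intro w
    refine ⟨n + 1, (?_ : Submodule.span ℂ Y ≤ LinearMap.ker _) (htop ▸ Submodule.mem_top)⟩
    rw [Submodule.span_le]
    rintro _ ⟨i, rfl⟩
    rw [SetLike.mem_coe, LinearMap.mem_ker, ← Module.End.mul_apply, (Commute.refl _).pow_pow,
      Module.End.mul_apply, hu.pow_toEnd_f_eq_zero_of_eq_nat rfl, map_zero]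

end FiniteDimensional

end Sl2

namespace SchrodingerAlgebra

open LieModule

theorem isSl2Triple : IsSl2Triple h e f where
  h_ne_zero := basis.ne_zero 1
  lie_e_f := lie_e_f
  lie_h_e_nsmul := by rw [lie_h_e, ← Nat.cast_smul_eq_nsmul ℂ, Nat.cast_ofNat]
  lie_h_f_nsmul := by rw [lie_h_f, ← Nat.cast_smul_eq_nsmul ℂ, Nat.cast_ofNat, neg_smul]

section Modules

variable {M : Type*} [AddCommGroup M] [Module ℂ M] [LieRingModule SchrodingerAlgebra M]
  [LieModule ℂ SchrodingerAlgebra M] {μ c : ℂ} {n : ℕ} {v : M}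

theorem isIntegrable_of_sl2 {ι : Type*} {W : ι → LieSubmodule ℂ sl2 M}
    (hW : ∀ i, IsIrreducible ℂ sl2 (W i)) (hfin : ∀ i, FiniteDimensional ℂ (W i))
    (htop : ⨆ i, (W i).toSubmodule = ⊤) : IsIntegrable M e h f := by
  have hsub : {e, h, f} ⊆ (sl2 : Set SchrodingerAlgebra) := by
    rw [← LieSubalgebra.coe_toSubmodule, sl2_toSubmodule_eq_span]
    exact Submodule.subset_span
  let e' : sl2 := ⟨e, hsub (by simp)⟩
  let h' : sl2 := ⟨h, hsub (by simp)⟩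
  let f' : sl2 := ⟨f, hsub (by simp)⟩
  have t : IsSl2Triple h' e' f' :=
    ⟨fun h0 => isSl2Triple.h_ne_zero (congrArg Subtype.val h0), Subtype.ext isSl2Triple.lie_e_f,
      Subtype.ext isSl2Triple.lie_h_e_nsmul, Subtype.ext isSl2Triple.lie_h_f_nsmul⟩
  have hspan : Submodule.span ℂ {e', h', f'} = ⊤ := by
    refine Submodule.map_injective_of_injective sl2.toSubmodule.injective_subtype ?_
    rw [Submodule.map_span, Submodule.map_top, Submodule.range_subtype, Set.image_insert_eq,
      Set.image_pair]
    exact sl2_toSubmodule_eq_span.symm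
  have hM : IsIntegrable M e' h' f' :=
    isIntegrable_of_iSup_eq_top (fun i => isIntegrable_of_isIrreducible t hspan) htop
  exact ⟨hM.span_stringVectors, hM.exists_pow_toEnd_f_eq_zero⟩

theorem exists_highestWeightSpace_sub_one_eq_bot [Nontrivial M] (hM : IsIntegrable M e h f) :
    ∃ n : ℕ, highestWeightSpace M e h n ≠ ⊥ ∧ highestWeightSpace M e h (n - 1) = ⊥ := by
  classical
  have hex : ∃ n : ℕ, highestWeightSpace M e h n ≠ ⊥ := by
    by_contra! hbot
    refine top_ne_bot (hM.span_stringVectors.symm.trans (Submodule.span_eq_bot.mpr ?_))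
    rintro _ ⟨n, i, u, hu, rfl⟩
    rw [(Submodule.eq_bot_iff _).mp (hbot n) u hu, map_zero]
  refine ⟨Nat.find hex, Nat.find_spec hex, (Submodule.eq_bot_iff _).mpr fun u hu => ?_⟩
  by_contra hu0
  obtain ⟨m, hm⟩ := exists_nat_of_mem_highestWeightSpace isSl2Triple hM hu hu0
  have hlt : m < Nat.find hex := by
    rw [sub_eq_iff_eq_add] at hm
    norm_cast at hm
    omega
  exact Nat.find_min hex hlt fun hbot => hu0 ((Submodule.eq_bot_iff _).mp hbot u (hm ▸ hu))

theorem lie_p_mem_highestWeightSpace (hv : v ∈ highestWeightSpace M e h μ) :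
    ⁅p, v⁆ ∈ highestWeightSpace M e h (μ + 1) := by
  obtain ⟨he, hh⟩ := mem_highestWeightSpace.mp hv
  refine mem_highestWeightSpace.mpr ⟨?_, ?_⟩
  · rw [leibniz_lie, lie_e_p, he, zero_lie, lie_zero, add_zero]
  · rw [leibniz_lie, lie_h_p, hh, lie_smul]
    module

theorem pow_toEnd_p_mem_highestWeightSpace (hv : v ∈ highestWeightSpace M e h μ) (k : ℕ) :
    (toEnd ℂ SchrodingerAlgebra M p ^ k) v ∈ highestWeightSpace M e h (μ + k) := by
  induction k with
  | zero => simpa using hv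
  | succ k ih =>
    rw [pow_succ', Nat.cast_succ, ← add_assoc]
    exact lie_p_mem_highestWeightSpace ih

theorem smul_lie_q_sub_mem_highestWeightSpace (hv : v ∈ highestWeightSpace M e h μ) :
    (μ + 1) • ⁅q, v⁆ - ⁅f, ⁅p, v⁆⁆ ∈ highestWeightSpace M e h (μ - 1) := by
  obtain ⟨he, hh⟩ := mem_highestWeightSpace.mp hv
  obtain ⟨hep, hhp⟩ := mem_highestWeightSpace.mp (lie_p_mem_highestWeightSpace hv)
  refine mem_highestWeightSpace.mpr ⟨?_, ?_⟩
  · rw [lie_sub, lie_smul, leibniz_lie e q, leibniz_lie e f, lie_e_q, lie_e_f, he, hep, hhp]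
    simp
  · rw [lie_sub, lie_smul, leibniz_lie h q, leibniz_lie h f, lie_h_q, lie_h_f, hh, hhp]
    simp only [neg_lie, smul_lie, lie_smul]
    module

variable (M) in
theorem commute_toEnd_z (x : SchrodingerAlgebra) :
    Commute (toEnd ℂ SchrodingerAlgebra M z) (toEnd ℂ SchrodingerAlgebra M x) := by
  have := toEnd_mul_toEnd M x z
  rw [SchrodingerAlgebra.lie_z, map_zero, add_zero] at this
  exact this.symm

theorem lie_q_pow_toEnd_f (w : M) (i : ℕ) :
    ⁅q, (toEnd ℂ SchrodingerAlgebra M f ^ i) w⁆ =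
      (toEnd ℂ SchrodingerAlgebra M f ^ i) ⁅q, w⁆ := by
  have := toEnd_mul_toEnd M f q
  rw [lie_f_q, map_zero, add_zero] at this
  exact LinearMap.congr_fun (Commute.pow_right this.symm i).eq w

/-- A highest weight vector of weight `n` on which `z` acts by `c` and for which the highest weight
vector `(n + 1) q v - f p v` of weight `n - 1` vanishes. Thus every vector of the submodule
generated by `v` is a combination of the vectors `f ^ i p ^ k v`. -/
structure IsMinimalVector (n : ℕ) (c : ℂ) (v : M) : Prop where
  highest : v ∈ highestWeightSpace M e h n
  smul_lie_q : (n + 1 : ℂ) • ⁅q, v⁆ = ⁅f, ⁅p, v⁆⁆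
  lie_z_eq : ⁅z, v⁆ = c • v

/-- The vectors `f ^ i p ^ k v`, which span the submodule generated by a minimal vector `v`. -/
def monomialVectors (v : M) : Set M :=
  Set.range fun a : ℕ × ℕ =>
    (toEnd ℂ SchrodingerAlgebra M f ^ a.1) ((toEnd ℂ SchrodingerAlgebra M p ^ a.2) v)

theorem mem_span_monomialVectors (v : M) (i k : ℕ) :
    (toEnd ℂ SchrodingerAlgebra M f ^ i) ((toEnd ℂ SchrodingerAlgebra M p ^ k) v) ∈
      Submodule.span ℂ (monomialVectors v) :=
  Submodule.subset_span ⟨(i, k), rfl⟩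

theorem lie_f_mem_span_monomialVectors {w : M} (hw : w ∈ Submodule.span ℂ (monomialVectors v)) :
    ⁅f, w⁆ ∈ Submodule.span ℂ (monomialVectors v) := by
  refine lie_mem_span_of_forall (X := {f}) ?_ (Submodule.mem_span_singleton_self f) hw
  rintro _ rfl _ ⟨⟨i, k⟩, rfl⟩
  rw [← toEnd_apply_apply ℂ SchrodingerAlgebra M f, ← Module.End.mul_apply, ← pow_succ']
  exact mem_span_monomialVectors v _ _

namespace IsMinimalVector

theorem lie_z_pow_toEnd (hv : IsMinimalVector n c v) (x : SchrodingerAlgebra) (k : ℕ) :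
    ⁅z, (toEnd ℂ SchrodingerAlgebra M x ^ k) v⁆ = c • (toEnd ℂ SchrodingerAlgebra M x ^ k) v := by
  rw [← map_smul, ← hv.lie_z_eq]
  exact LinearMap.congr_fun ((commute_toEnd_z M x).pow_right k).eq v

theorem smul_lie_q_pow_toEnd_p (hv : IsMinimalVector n c v) (k : ℕ) :
    (2 * (n + k + 1) : ℂ) • ⁅q, (toEnd ℂ SchrodingerAlgebra M p ^ k) v⁆ =
      (2 : ℂ) • ⁅f, (toEnd ℂ SchrodingerAlgebra M p ^ (k + 1)) v⁆ -
        (c * k * (2 * n + k + 1)) • (toEnd ℂ SchrodingerAlgebra M p ^ (k - 1)) v := by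
  induction k with
  | zero => simp [mul_smul, hv.smul_lie_q]
  | succ k ih =>
    set w := (toEnd ℂ SchrodingerAlgebra M p ^ k) v with hw
    have hpow (j : ℕ) (u : M) : (toEnd ℂ SchrodingerAlgebra M p ^ (j + 1)) u =
        ⁅p, (toEnd ℂ SchrodingerAlgebra M p ^ j) u⁆ := by
      rw [pow_succ', Module.End.mul_apply, toEnd_apply_apply]
    have hz : ⁅z, w⁆ = c • w := hv.lie_z_pow_toEnd p k
    have hpq : ⁅q, ⁅p, w⁆⁆ = ⁅p, ⁅q, w⁆⁆ - c • w := by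
      rw [leibniz_lie p, lie_p_q, hz, add_sub_cancel_left]
    have hpf : ⁅p, ⁅f, ⁅p, w⁆⁆⁆ = ⁅f, ⁅p, ⁅p, w⁆⁆⁆ - ⁅q, ⁅p, w⁆⁆ := by
      rw [leibniz_lie f p ⁅p, w⁆, lie_f_p, add_sub_cancel_left]
    have hstep := congrArg (fun u => ⁅p, u⁆) ih
    have hk : (k : ℂ) • ⁅p, (toEnd ℂ SchrodingerAlgebra M p ^ (k - 1)) v⁆ = (k : ℂ) • w := by
      cases k with
      | zero => simp
      | succ k => rw [hw, hpow, Nat.add_sub_cancel]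
    simp only [lie_sub, lie_smul, hpow, ← hw, hpf] at hstep
    rw [Nat.add_sub_cancel, hpow (k + 1), hpow k, ← hw]
    push_cast
    linear_combination (norm := module)
      hstep + (2 * (n + k + 1) : ℂ) • hpq - (c * (2 * n + k + 1)) • hk

theorem lie_q_pow_toEnd_p_mem_span (hv : IsMinimalVector n c v) (i k : ℕ) :
    ⁅q, (toEnd ℂ SchrodingerAlgebra M f ^ i) ((toEnd ℂ SchrodingerAlgebra M p ^ k) v)⁆ ∈
      Submodule.span ℂ (monomialVectors v) := by
  have hne : (2 * (n + k + 1) : ℂ) ≠ 0 := by norm_cast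
  rw [lie_q_pow_toEnd_f, ← Submodule.smul_mem_iff _ hne, ← map_smul, hv.smul_lie_q_pow_toEnd_p,
    map_sub, map_smul, map_smul, ← toEnd_apply_apply ℂ SchrodingerAlgebra M f,
    ← Module.End.mul_apply, ← pow_succ]
  exact sub_mem (Submodule.smul_mem _ _ (mem_span_monomialVectors v _ _))
    (Submodule.smul_mem _ _ (mem_span_monomialVectors v _ _))

theorem lie_p_mem_span (hv : IsMinimalVector n c v) (i k : ℕ) :
    ⁅p, (toEnd ℂ SchrodingerAlgebra M f ^ i) ((toEnd ℂ SchrodingerAlgebra M p ^ k) v)⁆ ∈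
      Submodule.span ℂ (monomialVectors v) := by
  induction i with
  | zero => simpa [pow_succ'] using mem_span_monomialVectors v 0 (k + 1)
  | succ i ih =>
    have hpf (w : M) : ⁅p, ⁅f, w⁆⁆ = ⁅f, ⁅p, w⁆⁆ - ⁅q, w⁆ := by
      rw [leibniz_lie f, lie_f_p, add_sub_cancel_left]
    rw [pow_succ', Module.End.mul_apply, toEnd_apply_apply, hpf]
    exact sub_mem (lie_f_mem_span_monomialVectors ih) (hv.lie_q_pow_toEnd_p_mem_span i k)

theorem lie_e_mem_span (hv : IsMinimalVector n c v) (i k : ℕ) :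
    ⁅e, (toEnd ℂ SchrodingerAlgebra M f ^ i) ((toEnd ℂ SchrodingerAlgebra M p ^ k) v)⁆ ∈
      Submodule.span ℂ (monomialVectors v) := by
  obtain ⟨he, hh⟩ := mem_highestWeightSpace.mp
    (pow_toEnd_p_mem_highestWeightSpace hv.highest k)
  cases i with
  | zero =>
    rw [pow_zero, Module.End.one_apply, he]
    exact zero_mem _
  | succ i =>
    rw [lie_e_pow_succ_toEnd_f isSl2Triple he, hh, ← sub_smul, map_smul]
    exact Submodule.smul_mem _ _ (Submodule.smul_mem _ _ (mem_span_monomialVectors v _ _))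

theorem lie_basis_mem_span (hv : IsMinimalVector n c v) :
    ∀ x ∈ Set.range basis, ∀ w ∈ monomialVectors v,
      ⁅x, w⁆ ∈ Submodule.span ℂ (monomialVectors v) := by
  rintro _ ⟨j, rfl⟩ _ ⟨⟨i, k⟩, rfl⟩
  fin_cases j
  · exact hv.lie_e_mem_span i k
  · change ⁅h, _⁆ ∈ _
    rw [lie_h_pow_toEnd_f isSl2Triple, (mem_highestWeightSpace.mp
      (pow_toEnd_p_mem_highestWeightSpace hv.highest k)).2, ← sub_smul, map_smul]
    exact Submodule.smul_mem _ _ (mem_span_monomialVectors v _ _)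
  · exact lie_f_mem_span_monomialVectors (mem_span_monomialVectors v _ _)
  · exact hv.lie_p_mem_span i k
  · exact hv.lie_q_pow_toEnd_p_mem_span i k
  · have hz := LinearMap.congr_fun ((commute_toEnd_z M f).pow_right i).eq
      ((toEnd ℂ SchrodingerAlgebra M p ^ k) v)
    change ⁅z, (toEnd ℂ SchrodingerAlgebra M f ^ i) _⁆ =
      (toEnd ℂ SchrodingerAlgebra M f ^ i) ⁅z, _⁆ at hz
    change ⁅z, (toEnd ℂ SchrodingerAlgebra M f ^ i) _⁆ ∈ _
    rw [hz, hv.lie_z_pow_toEnd, map_smul]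
    exact Submodule.smul_mem _ _ (mem_span_monomialVectors v _ _)

/-- The submodule generated by a minimal vector, realised as the span of its monomials. -/
noncomputable def submodule (hv : IsMinimalVector n c v) : LieSubmodule ℂ SchrodingerAlgebra M :=
  spanLieSubmodule basis.span_eq hv.lie_basis_mem_span

theorem self_mem_submodule (hv : IsMinimalVector n c v) : v ∈ hv.submodule :=
  mem_span_monomialVectors v 0 0

theorem submodule_eq_top [LieModule.IsIrreducible ℂ SchrodingerAlgebra M]
    (hv : IsMinimalVector n c v) (hv0 : v ≠ 0) : hv.submodule = ⊤ :=
  (eq_bot_or_eq_top _).resolve_left fun h =>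
    hv0 ((LieSubmodule.eq_bot_iff _).mp h v hv.self_mem_submodule)

theorem mem_span_of_mem_highestWeightSpace (hv : IsMinimalVector n c v) {m : ℕ} {w : M}
    (hw : w ∈ hv.submodule) (hm : w ∈ highestWeightSpace M e h m) :
    w ∈ Submodule.span ℂ {u | ∃ k, n + k = m ∧ (toEnd ℂ SchrodingerAlgebra M p ^ k) v = u} := by
  have hhw (k : ℕ) : (toEnd ℂ SchrodingerAlgebra M p ^ k) v ∈
      highestWeightSpace M e h (n + k : ℕ) := by
    rw [Nat.cast_add]
    exact pow_toEnd_p_mem_highestWeightSpace hv.highest k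
  have hY : monomialVectors v ⊆ stringVectors M e h f := by
    rintro _ ⟨⟨i, k⟩, rfl⟩
    exact ⟨n + k, i, _, hhw k, rfl⟩
  refine Submodule.span_le.mpr ?_ (mem_span_inter_highestWeightSpace isSl2Triple hY hw hm)
  rintro u ⟨⟨⟨i, k⟩, hik : (toEnd ℂ SchrodingerAlgebra M f ^ i) _ = u⟩, hu⟩
  obtain rfl | hu0 := eq_or_ne u 0
  · exact zero_mem _
  have hT := pow_toEnd_f_mem_eigenspace_twistedCasimir isSl2Triple (hhw k) i
  have hm0 := mem_eigenspace_twistedCasimir isSl2Triple hu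
  rw [hik, Module.End.mem_eigenspace_iff] at hT
  rw [Module.End.mem_eigenspace_iff] at hm0
  obtain ⟨hkm, hi⟩ := twistedCasimirValue_inj.mp (smul_left_injective ℂ hu0 (hT.symm.trans hm0))
  obtain rfl : i = 0 := by simpa using hi
  exact Submodule.subset_span ⟨k, hkm, hik⟩

theorem mem_span_singleton (hv : IsMinimalVector n c v) {w : M} (hw : w ∈ hv.submodule)
    (hn : w ∈ highestWeightSpace M e h n) : w ∈ Submodule.span ℂ {v} := by
  refine Submodule.span_mono ?_ (hv.mem_span_of_mem_highestWeightSpace hw hn)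
  rintro _ ⟨k, hk, rfl⟩
  obtain rfl : k = 0 := by omega
  rfl

theorem eq_zero_of_lt (hv : IsMinimalVector n c v) {m : ℕ} (hmn : m < n) {w : M}
    (hw : w ∈ hv.submodule) (hm : w ∈ highestWeightSpace M e h m) : w = 0 := by
  have hempty : {u | ∃ k, n + k = m ∧ (toEnd ℂ SchrodingerAlgebra M p ^ k) v = u} = ∅ := by
    refine Set.eq_empty_of_forall_notMem ?_
    rintro _ ⟨k, hk, -⟩
    omega
  simpa [hempty] using hv.mem_span_of_mem_highestWeightSpace hw hm

theorem lie_p (hv : IsMinimalVector n 0 v) : IsMinimalVector (n + 1) 0 ⁅p, v⁆ where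
  highest := by
    rw [Nat.cast_succ]
    exact lie_p_mem_highestWeightSpace hv.highest
  smul_lie_q := by
    have := hv.smul_lie_q_pow_toEnd_p 1
    simp only [pow_succ', pow_zero, mul_one, Module.End.mul_apply, toEnd_apply_apply, mul_smul,
      zero_smul, sub_zero, Nat.cast_one, zero_mul] at this
    rw [Nat.cast_succ]
    exact smul_right_injective M (two_ne_zero (α := ℂ)) this
  lie_z_eq := by simpa using hv.lie_z_pow_toEnd p 1

theorem ne_zero_of_not_finiteDimensional [LieModule.IsIrreducible ℂ SchrodingerAlgebra M]
    (hM : IsIntegrable M e h f) (hinf : ¬ FiniteDimensional ℂ M) (hv : IsMinimalVector n c v)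
    (hv0 : v ≠ 0) : c ≠ 0 := by
  rintro rfl
  have hp : ⁅p, v⁆ = 0 := by
    by_contra hp0
    refine hv0 (hv.lie_p.eq_zero_of_lt n.lt_succ_self ?_ hv.highest)
    rw [hv.lie_p.submodule_eq_top hp0]
    exact LieSubmodule.mem_top v
  obtain ⟨N, hN⟩ := hM.exists_pow_toEnd_f_eq_zero v
  let Y : Set M := (fun i => (toEnd ℂ SchrodingerAlgebra M f ^ i) v) '' Set.Iio N
  have htop : Submodule.span ℂ Y = ⊤ := by
    refine eq_top_iff.mpr ((congrArg LieSubmodule.toSubmodule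
      (hv.submodule_eq_top hv0)).symm.trans_le (Submodule.span_le.mpr ?_))
    rintro _ ⟨⟨i, k⟩, rfl⟩
    rw [SetLike.mem_coe]
    cases k with
    | zero =>
      obtain hi | hi := lt_or_ge i N
      · exact Submodule.subset_span ⟨i, hi, rfl⟩
      · simp [Module.End.pow_map_zero_of_le hi hN]
    | succ k => simp [pow_succ, hp]
  exact hinf ⟨htop ▸ Submodule.fg_span ((Set.finite_Iio N).image _)⟩

section Extension

variable {A B C : Type*} [AddCommGroup A] [Module ℂ A] [LieRingModule SchrodingerAlgebra A]
  [LieModule ℂ SchrodingerAlgebra A] [AddCommGroup B] [Module ℂ B]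
  [LieRingModule SchrodingerAlgebra B] [LieModule ℂ SchrodingerAlgebra B]
  [AddCommGroup C] [Module ℂ C] [LieRingModule SchrodingerAlgebra C]
  [LieModule ℂ SchrodingerAlgebra C] {ι : A →ₗ⁅ℂ,SchrodingerAlgebra⁆ B}
  {π : B →ₗ⁅ℂ,SchrodingerAlgebra⁆ C}

theorem exists_isMinimalVector_of_exact (hι : Function.Injective ι) (hexact : Function.Exact ι π)
    (hπ : Function.Surjective π) (hA : IsIntegrable A e h f) (hC : IsIntegrable C e h f)
    (hbot : highestWeightSpace A e h (n - 1) = ⊥) (hz : ∀ b : B, ⁅z, b⁆ = c • b) {v : C}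
    (hv : IsMinimalVector n c v) : ∃ w : B, IsMinimalVector n c w ∧ π w = v := by
  obtain ⟨w, hw, rfl⟩ := exists_mem_highestWeightSpace_of_exact hι hexact hπ isSl2Triple hA
    hC.exists_pow_toEnd_f_eq_zero hv.highest
  refine ⟨w, ⟨hw, sub_eq_zero.mp ?_, hz w⟩, rfl⟩
  have hd := smul_lie_q_sub_mem_highestWeightSpace hw
  obtain ⟨a, ha⟩ := (hexact ((n + 1 : ℂ) • ⁅q, w⁆ - ⁅f, ⁅p, w⁆⁆)).mp <| by
    rw [map_sub, map_smul, LieModuleHom.map_lie, LieModuleHom.map_lie, LieModuleHom.map_lie,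
      hv.smul_lie_q, sub_self]
  rw [← ha] at hd ⊢
  rw [mem_highestWeightSpace, ← LieModuleHom.map_lie, ← LieModuleHom.map_lie, ← map_smul,
    map_eq_zero_iff ι hι, hι.eq_iff, ← mem_highestWeightSpace, hbot, Submodule.mem_bot] at hd
  rw [hd, map_zero]

/-- The complement is the submodule generated by a lift of the minimal vector of `C`: its highest
weight space of weight `n` is a line, so it does not contain `A`. -/
theorem exists_section_of_exact [LieModule.IsIrreducible ℂ SchrodingerAlgebra A]
    [LieModule.IsIrreducible ℂ SchrodingerAlgebra C] (hι : Function.Injective ι)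
    (hexact : Function.Exact ι π) (hπ : Function.Surjective π) (hA : IsIntegrable A e h f)
    (hC : IsIntegrable C e h f) (hbot : highestWeightSpace A e h (n - 1) = ⊥)
    (hne : highestWeightSpace A e h n ≠ ⊥) (hz : ∀ b : B, ⁅z, b⁆ = c • b) {v : C}
    (hv : IsMinimalVector n c v) (hv0 : v ≠ 0) :
    ∃ σ : C →ₗ⁅ℂ,SchrodingerAlgebra⁆ B, ∀ x, π (σ x) = x := by
  obtain ⟨w, hw, rfl⟩ := exists_isMinimalVector_of_exact hι hexact hπ hA hC hbot hz hv
  let φ : hw.submodule →ₗ⁅ℂ,SchrodingerAlgebra⁆ C := π.comp hw.submodule.incl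
  have hcomap : hw.submodule.comap ι = ⊥ := by
    refine (eq_bot_or_eq_top _).resolve_right fun htop => hne ?_
    refine (Submodule.eq_bot_iff _).mpr fun a ha => ?_
    obtain ⟨r, hr⟩ := Submodule.mem_span_singleton.mp <| hw.mem_span_singleton
      (LieSubmodule.mem_comap.mp (htop ▸ LieSubmodule.mem_top a)) (map_mem_highestWeightSpace ι ha)
    have hr0 : r = 0 := by
      have := congrArg π hr
      rw [hexact.apply_apply_eq_zero, map_smul, smul_eq_zero] at this
      exact this.resolve_right hv0
    exact hι (by rw [← hr, hr0, zero_smul, map_zero])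
  have hinj : Function.Injective φ := by
    refine (injective_iff_map_eq_zero φ).mpr fun x hx => Subtype.ext ?_
    obtain ⟨a, ha⟩ := (hexact x).mp hx
    have : a ∈ hw.submodule.comap ι := LieSubmodule.mem_comap.mpr (ha ▸ x.2)
    rw [hcomap, LieSubmodule.mem_bot] at this
    rw [← ha, this, map_zero]
    rfl
  have hsurj : Function.Surjective φ := by
    refine φ.range_eq_top.mp ((eq_bot_or_eq_top _).resolve_left fun h => hv0 ?_)
    exact (LieSubmodule.eq_bot_iff _).mp h _ (φ.mem_range_self ⟨w, hw.self_mem_submodule⟩)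
  let ψ : hw.submodule ≃ₗ⁅ℂ,SchrodingerAlgebra⁆ C :=
    { LinearEquiv.ofBijective (φ : hw.submodule →ₗ[ℂ] C) ⟨hinj, hsurj⟩, φ with }
  exact ⟨hw.submodule.incl.comp ψ.symm, fun x => ψ.apply_symm_apply x⟩

end Extension

end IsMinimalVector

section Irreducible

variable (V : Type*) [AddCommGroup V] [Module ℂ V] [LieRingModule SchrodingerAlgebra V]
  [LieModule ℂ SchrodingerAlgebra V] [LieModule.IsIrreducible ℂ SchrodingerAlgebra V]

theorem exists_eq_smul_of_commute {T : Module.End ℂ V}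
    (hT : ∀ x, Commute T (toEnd ℂ SchrodingerAlgebra V x)) : ∃ a : ℂ, T = a • 1 := by
  have : Uncountable ℂ := Complex.ofReal_injective.uncountable
  obtain ⟨a, ha⟩ := exists_forall_eq_smul_of_isIrreducible (Set.countable_range _) basis.span_eq
    ({ T with map_lie' := fun {x v} => LinearMap.congr_fun (hT x).eq v } :
      V →ₗ⁅ℂ,SchrodingerAlgebra⁆ V)
  exact ⟨a, LinearMap.ext ha⟩

theorem exists_lie_z_eq_smul : ∃ c : ℂ, ∀ v : V, ⁅z, v⁆ = c • v := by
  obtain ⟨c, hc⟩ := exists_eq_smul_of_commute V (commute_toEnd_z V)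
  exact ⟨c, LinearMap.congr_fun hc⟩

theorem exists_apply_z_eq_smul_one (D : LieDerivation ℂ SchrodingerAlgebra (V →ₗ[ℂ] V)) :
    ∃ a : ℂ, D z = a • 1 := by
  obtain ⟨c, hc⟩ := exists_lie_z_eq_smul V
  refine exists_eq_smul_of_commute V fun x => LinearMap.ext fun v => ?_
  have hcentral : D ⁅x, z⁆ v = 0 := by rw [SchrodingerAlgebra.lie_z, map_zero, LinearMap.zero_apply]
  rw [LieDerivation.apply_lie_eq_sub, LinearMap.sub_apply, LieHom.lie_apply, LieHom.lie_apply, hc,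
    hc, map_smul, sub_self, sub_zero] at hcentral
  exact (sub_eq_zero.mp hcentral).symm

variable {V} in
theorem exists_isMinimalVector (hV : IsIntegrable V e h f) (hc : ∀ v : V, ⁅z, v⁆ = c • v) :
    ∃ (n : ℕ) (v : V), IsMinimalVector n c v ∧ v ≠ 0 ∧ highestWeightSpace V e h (n - 1) = ⊥ := by
  have := LieModule.nontrivial_of_isIrreducible ℂ SchrodingerAlgebra V
  obtain ⟨n, hne, hbot⟩ := exists_highestWeightSpace_sub_one_eq_bot hV
  obtain ⟨v, hv, hv0⟩ := Submodule.exists_mem_ne_zero_of_ne_bot hne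
  have hq := smul_lie_q_sub_mem_highestWeightSpace hv
  rw [hbot, Submodule.mem_bot, sub_eq_zero] at hq
  exact ⟨n, v, ⟨hv, hq, hc v⟩, hv0, hbot⟩

variable {V} in
theorem mem_range_inner_of_apply_z_eq_zero (hV : IsIntegrable V e h f)
    {D : LieDerivation ℂ SchrodingerAlgebra (V →ₗ[ℂ] V)} (hD : D z = 0) :
    D ∈ LinearMap.range (LieDerivation.inner ℂ SchrodingerAlgebra (V →ₗ[ℂ] V)) := by
  obtain ⟨c, hc⟩ := exists_lie_z_eq_smul V
  obtain ⟨n, v, hv, hv0, hbot⟩ := exists_isMinimalVector hV hc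
  have hz (m : DerivationExtension D) : ⁅z, m⁆ = c • m := by
    refine Prod.ext (hc m.1) ?_
    change ⁅z, m.2⁆ + D z m.1 = c • m.2
    rw [hD, hc, LinearMap.zero_apply, add_zero]
  obtain ⟨σ, hσ⟩ := IsMinimalVector.exists_section_of_exact (DerivationExtension.inr_injective D)
    (DerivationExtension.fst_eq_zero_iff D) (DerivationExtension.fst_surjective D) hV hV hbot
    (Submodule.ne_bot_iff _ |>.mpr ⟨v, hv.highest, hv0⟩) hz hv hv0
  exact DerivationExtension.mem_range_inner_of_section D σ hσ

theorem apply_z_eq_zero_of_mem_range_inner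
    {D : LieDerivation ℂ SchrodingerAlgebra (V →ₗ[ℂ] V)}
    (hD : D ∈ LinearMap.range (LieDerivation.inner ℂ SchrodingerAlgebra (V →ₗ[ℂ] V))) :
    D z = 0 := by
  obtain ⟨T, rfl⟩ := hD
  obtain ⟨c, hc⟩ := exists_lie_z_eq_smul V
  ext v
  simp [hc]

end Irreducible

/-- The grading of the Schrödinger algebra in which `sl₂`, `p, q` and `z` have degrees `0`, `1/2`
and `1`, as the derivation multiplying each element by its degree. -/
noncomputable def gradingDerivation : LieDerivation ℂ SchrodingerAlgebra SchrodingerAlgebra where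
  toFun x := (x 3 / 2) • p + (x 4 / 2) • q + x 5 • z
  map_add' x y := by simp only [add_apply]; module
  map_smul' c x := by simp only [smul_apply, RingHom.id_apply]; module
  leibniz' x y := by
    ext i
    fin_cases i <;> simp [p, q, z, basis_apply, sub_eq_add_neg] <;> ring

theorem gradingDerivation_z : gradingDerivation z = z := by
  simp [gradingDerivation, z, basis_apply]

variable (M) in
/-- The grading derivation followed by the action on `M`: the first-order deformation of `M`
obtained by rescaling `p`, `q` and `z`. -/
noncomputable def gradingDeformation : LieDerivation ℂ SchrodingerAlgebra (M →ₗ[ℂ] M) where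
  __ := (toEnd ℂ SchrodingerAlgebra M : SchrodingerAlgebra →ₗ[ℂ] Module.End ℂ M) ∘ₗ
    (gradingDerivation : SchrodingerAlgebra →ₗ[ℂ] SchrodingerAlgebra)
  leibniz' x y := by
    ext v
    simp

theorem gradingDeformation_z : gradingDeformation M z = toEnd ℂ SchrodingerAlgebra M z :=
  congrArg (toEnd ℂ SchrodingerAlgebra M) gradingDerivation_z

theorem finrank_outerDerivations_eq_one [LieModule.IsIrreducible ℂ SchrodingerAlgebra M]
    (hM : IsIntegrable M e h f) (hinf : ¬ FiniteDimensional ℂ M) :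
    Module.finrank ℂ (OuterDerivations ℂ SchrodingerAlgebra (M →ₗ[ℂ] M)) = 1 := by
  obtain ⟨c, hc⟩ := exists_lie_z_eq_smul M
  obtain ⟨n, v, hv, hv0, -⟩ := exists_isMinimalVector hM hc
  have hc0 : c ≠ 0 := hv.ne_zero_of_not_finiteDimensional hM hinf hv0
  have hzc : gradingDeformation M z = c • 1 := gradingDeformation_z.trans (LinearMap.ext hc)
  refine finrank_eq_one (Submodule.Quotient.mk (gradingDeformation M)) ?_ fun w => ?_
  · rw [Ne, Submodule.Quotient.mk_eq_zero]
    intro hinner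
    have hcv := LinearMap.congr_fun (hzc.symm.trans (apply_z_eq_zero_of_mem_range_inner M hinner)) v
    exact smul_ne_zero hc0 hv0 hcv
  · obtain ⟨D, rfl⟩ := Submodule.Quotient.mk_surjective _ w
    obtain ⟨a, ha⟩ := exists_apply_z_eq_smul_one M D
    refine ⟨a / c, (Submodule.Quotient.eq _).mpr (mem_range_inner_of_apply_z_eq_zero hM ?_)⟩
    rw [LieDerivation.sub_apply, LieDerivation.smul_apply, hzc, ha, smul_smul,
      div_mul_cancel₀ _ hc0, sub_self]

end Modules

end SchrodingerAlgebra

theorem theorem5p16_general {V : Type*} [AddCommGroup V] [Module ℂ V]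
    [LieRingModule SchrodingerAlgebra V] [LieModule ℂ SchrodingerAlgebra V]
    [LieModule.IsIrreducible ℂ SchrodingerAlgebra V] {ι : Type*}
    {W : ι → LieSubmodule ℂ SchrodingerAlgebra.sl2 V}
    (hW : ∀ i, LieModule.IsIrreducible ℂ SchrodingerAlgebra.sl2 (W i))
    (hfin : ∀ i, FiniteDimensional ℂ (W i)) (htop : ⨆ i, (W i).toSubmodule = ⊤)
    (hinf : ¬ FiniteDimensional ℂ V) :
    Nonempty (CategoryTheory.Abelian.Ext (envelopingModule SchrodingerAlgebra V)
      (envelopingModule SchrodingerAlgebra V) 1 ≃ₗ[ℂ] ℂ) := by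
  let _ := Module.compHom V (UniversalEnvelopingAlgebra.lift ℂ
    (LieModule.toEnd ℂ SchrodingerAlgebra V)).toRingHom
  have : IsEnvelopingModule ℂ SchrodingerAlgebra V := isEnvelopingModule_compHom V
  obtain ⟨Φ⟩ := nonempty_ext_linearEquiv_outerDerivations (K := ℂ) (L := SchrodingerAlgebra)
    (V := V) (W := V)
  obtain ⟨Ψ⟩ := Module.nonempty_linearEquiv_of_finrank_eq_one
    (SchrodingerAlgebra.finrank_outerDerivations_eq_one
      (SchrodingerAlgebra.isIntegrable_of_sl2 hW hfin htop) hinf)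
  exact ⟨Φ ≪≫ₗ Ψ.symm⟩

theorem theorem5p16 {V : Type*} [AddCommGroup V] [Module ℂ V]
    [LieRingModule SchrodingerAlgebra V] [LieModule ℂ SchrodingerAlgebra V]
    (hsimple : LieModule.IsIrreducible ℂ SchrodingerAlgebra V)
    (hHC : IsHarishChandraModule SchrodingerAlgebra.sl2 V)
    (hinf : ¬ FiniteDimensional ℂ V) :
    Nonempty (CategoryTheory.Abelian.Ext (envelopingModule SchrodingerAlgebra V)
      (envelopingModule SchrodingerAlgebra V) 1 ≃ₗ[ℂ] ℂ) := by
  classical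
  obtain ⟨ι, W, hint, hW, -⟩ := hHC
  exact theorem5p16_general (fun i => (hW i).1) (fun i => (hW i).2) hint.submodule_iSup_eq_top hinf
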